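/- Let $p$ be a prime number, let $K$ be a (non-archimedean) local field of characteristic $p$ with finite residue field $k$, and let $L$ be a finite Galois extension of $K$ with group $G=\operatorname{Gal}(L|K)$. Suppose that $L|K$ is tamely ramified (its ramification index is prime to $p$) and split, in the sense that the short exact sequence $1\to T\to G\to G/T\to 1$, where $T$ is the inertia subgroup of $G$, has a section that is a morphism of groups. Let $\wp\colon L\to L$ be the additive map $\wp(x)=x^p-x$. Then the $\mathbf F_p[G]$-module $L^+/\wp(L^+)$, with the action of $G$ induced by its action on $L$, is isomorphic to $\mathbf F_p\oplus k[G]^{(\mathbf N)}$, and also to $\mathbf F_p\oplus \mathbf F_p[G]^{(\mathbf N)}$. Here $G$ acts trivially on $\mathbf F_p$, $k[G]$ is regarded as an $\mathbf F_p[G]$-module by restriction of scalars along $\mathbf F_p[G]\to k[G]$, and $M^{(\mathbf N)}$ denotes the direct sum of copies of $M$ indexed by $\mathbf N$. -/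

import Mathlib

open scoped ValuativeRel

namespace LittleGalois

section Ramification

variable (K L : Type*) [Field K] [ValuativeRel K] [Field L] [Algebra K L]

/-- The ring of integers `𝔬_L` of a finite extension `L` of a local field `K`:
the integral closure in `L` of the ring of integers of `K`. -/
abbrev IntegersIn : Type _ := integralClosure 𝒪[K] L

/-- The intersection of the maximal ideals of `𝔬_L`. When `K` is a local field and `L` is a finite
extension, `𝔬_L` is a local ring, and this is its maximal ideal `𝔭_L`. -/
noncomputable def maxIdeal : Ideal (IntegersIn K L) := Ideal.jacobson ⊥

/-- The inertia subgroup `T` of `Gal(L|K)`: the automorphisms that act trivially on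
`𝔬_L / 𝔭_L`. -/
noncomputable def inertiaSubgroup : Subgroup Gal(L/K) where
  carrier := {g | ∀ x : IntegersIn K L, g • x - x ∈ maxIdeal K L}
  mul_mem' {a b} ha hb x := by
    simpa [mul_smul] using add_mem (ha (b • x)) (hb x)
  one_mem' := by simp
  inv_mem' {a} ha x := by
    simpa using sub_mem_comm_iff.mp (ha (a⁻¹ • x))

theorem smul_mem_maxIdeal (g : Gal(L/K)) {x : IntegersIn K L} (hx : x ∈ maxIdeal K L) :
    g • x ∈ maxIdeal K L := by
  unfold maxIdeal at *
  rw [Ideal.mem_jacobson_bot] at hx ⊢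
  intro y
  have h := (hx (g⁻¹ • y)).map (MulSemiringAction.toRingHom Gal(L/K) (IntegersIn K L) g)
  simpa using h

instance inertiaSubgroup_normal : (inertiaSubgroup K L).Normal where
  conj_mem t ht g x := by
    have h := smul_mem_maxIdeal K L g (ht (g⁻¹ • x))
    simpa [mul_smul, smul_sub] using h

/-- `L|K` is tamely ramified: the ramification index of (the maximal ideal of) `𝔬_L` over `𝒪[K]`
is prime to the residue characteristic. (Residue fields of local fields are finite, so that residue
extensions are automatically separable.) -/
def IsTamelyRamified : Prop :=
  ∀ P : Ideal (IntegersIn K L), P.IsMaximal → ¬ ringChar 𝓀[K] ∣ P.ramificationIdx 𝒪[K]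

/-- `L|K` is split: the short exact sequence `1 → T → G → G/T → 1`, with `G = Gal(L|K)` and `T` its
inertia subgroup, has a section that is a morphism of groups. -/
def IsSplit : Prop :=
  ∃ s : (Gal(L/K) ⧸ inertiaSubgroup K L) →* Gal(L/K),
    ∀ c, QuotientGroup.mk' (inertiaSubgroup K L) (s c) = c

end Ramification

section ArtinSchreier

variable (K L : Type*) [Field K] [Field L] [Algebra K L] (p : ℕ) [Fact p.Prime] [CharP K p]

/-- The additive map `℘ : L → L`, `℘(x) = x ^ p - x`, where `L` is an extension of a field `K` of
characteristic `p`. -/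
def wp : L →+ L where
  toFun x := x ^ p - x
  map_zero' := by simp [(Fact.out : p.Prime).ne_zero]
  map_add' x y := by
    have : CharP L p := charP_of_injective_algebraMap (algebraMap K L).injective p
    rw [add_pow_char]
    ring

/-- The quotient `L⁺/℘(L⁺)`. -/
abbrev ASQuotient : Type _ := L ⧸ (wp K L p).range

instance : Module (ZMod p) (ASQuotient K L p) := AddCommGroup.zmodModule (n := p) (by
  intro x
  have : CharP L p := charP_of_injective_algebraMap (algebraMap K L).injective p
  induction x using QuotientAddGroup.induction_on with
  | H x => rw [← QuotientAddGroup.mk_nsmul, nsmul_eq_mul, CharP.cast_eq_zero, zero_mul]; rfl)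

theorem wp_range_le_comap (g : Gal(L/K)) :
    (wp K L p).range ≤ (wp K L p).range.comap (g : L →+ L) := by
  rintro _ ⟨x, rfl⟩
  exact ⟨g x, by simp [wp]⟩

/-- The natural action of `G = Gal(L|K)` on `L⁺/℘(L⁺)`, as an `𝔽_p`-linear representation. -/
def asRep : Representation (ZMod p) Gal(L/K) (ASQuotient K L p) where
  toFun g := AddMonoidHom.toZModLinearMap p
    (QuotientAddGroup.map _ _ (g : L →+ L) (wp_range_le_comap K L p g))
  map_one' := by
    ext x
    induction x using QuotientAddGroup.induction_on with
    | H x => rfl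
  map_mul' g h := by
    ext x
    induction x using QuotientAddGroup.induction_on with
    | H x => rfl

end ArtinSchreier

section ResidueGroupAlgebra

variable (K L : Type*) [Field K] [ValuativeRel K] [Field L] [Algebra K L]

/-- The group algebra `k[G]`, where `k` is the residue field of `K` and `G = Gal(L|K)`. -/
def ResidueGroupAlgebra : Type _ := MonoidAlgebra 𝓀[K] Gal(L/K)

noncomputable instance : AddCommGroup (ResidueGroupAlgebra K L) :=
  inferInstanceAs (AddCommGroup (MonoidAlgebra 𝓀[K] Gal(L/K)))

noncomputable instance : Module (MonoidAlgebra 𝓀[K] Gal(L/K)) (ResidueGroupAlgebra K L) :=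
  inferInstanceAs (Module (MonoidAlgebra 𝓀[K] Gal(L/K)) (MonoidAlgebra 𝓀[K] Gal(L/K)))

instance residueField_charP (p : ℕ) [Fact p.Prime] [CharP K p] : CharP 𝓀[K] p := by
  have h : (p : 𝒪[K]) = 0 := Subtype.ext (by simp)
  have h' : (p : 𝓀[K]) = 0 := by
    rw [← map_natCast (IsLocalRing.residue 𝒪[K]), h, map_zero]
  exact ringChar.of_eq (CharP.ringChar_of_prime_eq_zero Fact.out h')

/-- `k[G]` as an `𝔽_p[G]`-module, by restriction of scalars along `𝔽_p[G] → k[G]`. -/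
noncomputable instance (p : ℕ) [Fact p.Prime] [CharP K p] :
    Module (MonoidAlgebra (ZMod p) Gal(L/K)) (ResidueGroupAlgebra K L) :=
  Module.compHom _ (MonoidAlgebra.mapRingHom Gal(L/K) (ZMod.castHom (dvd_refl p) 𝓀[K]))

end ResidueGroupAlgebra

end LittleGalois

/-! Let `κ` be the residue field of `L`, `ϖ` a uniformizer and `x = ϖ⁻¹`. In characteristic `p`
there is a multiplicative and additive lift `θ : κ → 𝔬_L`. By Hensel's lemma `℘` is onto on the
maximal ideal, and `θ(b^p) x^(pm) ≡ θ(b) x^m` modulo `℘(L)`. Hence every class of `L/℘(L)` is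
represented by some `θ(a) + ∑ θ(aₙ) xⁿ`, a finite sum over `n > 0` prime to `p`. A comparison of
valuations shows that the `aₙ` are unique and that `a` is unique modulo `℘(κ)`
(`exists_eq_polarMap_add`, `eq_zero_of_polarMap_eq`). The constant terms contribute `κ/℘(κ)`, which
the absolute trace identifies with the trivial module `𝔽_p` (`exists_artinSchreier_generator`).

The action on the polar part is controlled by choosing `ϖ` well. Since `L|K` is tame and split, some
`ϖ` has `ϖ^e` in `K`, where `e` is the ramification index, and a complement `H` of the inertia group
`T` fixes it. Then `g ϖ = θ(χ g) ϖ` with `(χ g)^e = 1`, and `χ` is injective on `T`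
(`exists_equivariant_uniformizer`). The action on `θ(κ) xⁿ` therefore depends only on `n` modulo
`e`. Taking one exponent in each residue class modulo `e` gives a block `κ^e`. It is free of rank
one over `k[G]`: a normal basis of `κ|k` handles `H` and a Vandermonde determinant handles `T`
(`exists_addEquiv_pi`). Countably many blocks exhaust the exponents prime to `p`. Finally `k[G]` is
itself a nonzero finite free `𝔽_p[G]`-module, which gives the second description. -/

namespace LittleGalois

/-! ### Adic completeness and local rings -/

section Completeness

/-- In a basis, lying in `I ^ n • ⊤` means having all coordinates in `I ^ n`, so limits are taken
coordinate by coordinate. -/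
theorem isAdicComplete_of_finite_free {R : Type*} [CommRing R] (I : Ideal R) [IsAdicComplete I R]
    (M : Type*) [AddCommGroup M] [Module R M] [Module.Free R M] [Module.Finite R M] :
    IsAdicComplete I M := by
  let b := Module.Free.chooseBasis R M
  have key : ∀ (n : ℕ) (x : M), x ∈ (I ^ n • ⊤ : Submodule R M) ↔ ∀ i, b.repr x i ∈ I ^ n := by
    intro n x
    constructor
    · intro hx i
      have := Submodule.mem_map_of_mem (f := b.coord i) hx
      rw [Submodule.map_smul'', smul_eq_mul] at this
      exact Ideal.mul_le_left this
    · intro hx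
      rw [← b.sum_repr x]
      exact Submodule.sum_mem _ fun i _ => Submodule.smul_mem_smul (hx i) trivial
  refine { haus' := fun x hx => ?_, prec' := fun f hf => ?_ }
  · refine b.repr.map_eq_zero_iff.mp (Finsupp.ext fun i => ?_)
    refine IsHausdorff.haus' (I := I) _ fun n => ?_
    have := (key n x).mp (SModEq.zero.mp (hx n)) i
    simpa [SModEq.zero] using this
  · have hc : ∀ i, ∃ c : R, ∀ n, b.repr (f n) i ≡ c [SMOD (I ^ n • ⊤ : Submodule R R)] := by
      intro i
      refine IsPrecomplete.prec' _ fun {m n} hmn => ?_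
      have := (key m _).mp (SModEq.sub_mem.mp (hf hmn)) i
      simpa [SModEq.sub_mem] using this
    choose c hc using hc
    refine ⟨∑ i, c i • b i, fun n => SModEq.sub_mem.mpr ((key n _).mpr fun i => ?_)⟩
    have := SModEq.sub_mem.mp (hc i n)
    simpa [Finsupp.single_apply] using this

/-- An `I`-adic Cauchy sequence sampled at the multiples of `e` is `I ^ e`-adically Cauchy and has
the same limit. -/
theorem IsAdicComplete.of_pow {R : Type*} [CommRing R] (I : Ideal R) {e : ℕ} (he : e ≠ 0)
    [IsAdicComplete (I ^ e) R] : IsAdicComplete I R := by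
  have hle : ∀ n, n ≤ e * n := fun n => Nat.le_mul_of_pos_left n (Nat.pos_of_ne_zero he)
  refine { haus' := fun x hx => ?_, prec' := fun f hf => ?_ }
  · refine IsHausdorff.haus' (I := I ^ e) x fun n => ?_
    simpa [← pow_mul] using hx (e * n)
  · obtain ⟨c, hc⟩ := IsPrecomplete.prec' (I := I ^ e) (fun n => f (e * n)) (fun {m n} hmn => by
      simpa [← pow_mul] using hf (Nat.mul_le_mul_left e hmn))
    refine ⟨c, fun n => (hf (hle n)).trans ?_⟩
    have := SModEq.sub_mem.mp (hc n)
    rw [SModEq.sub_mem]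
    simp only [← pow_mul, smul_eq_mul, Ideal.mul_top] at this ⊢
    exact Ideal.pow_le_pow_right (hle n) this

/-- In a finite monoid every element has a power which is idempotent. -/
theorem exists_pow_isIdempotentElem {M : Type*} [Monoid M] [Finite M] (x : M) :
    ∃ n, n ≠ 0 ∧ IsIdempotentElem (x ^ n) := by
  obtain ⟨a, b, hne, hab⟩ := Finite.exists_ne_map_eq_of_infinite (fun n : ℕ => x ^ (n + 1))
  wlog h : a < b generalizing a b
  · exact this b a hne.symm hab.symm (lt_of_le_of_ne (not_lt.mp h) hne.symm)
  obtain ⟨d, rfl⟩ := Nat.exists_eq_add_of_lt h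
  have step : ∀ m, a + 1 ≤ m → x ^ (m + (d + 1)) = x ^ m := by
    intro m hm
    obtain ⟨j, rfl⟩ := Nat.exists_eq_add_of_le hm
    have : x ^ (a + 1) = x ^ (a + d + 1 + 1) := hab
    calc x ^ (a + 1 + j + (d + 1)) = x ^ (a + d + 1 + 1) * x ^ j := by
          rw [← pow_add]; congr 1; ring
      _ = _ := by rw [← this, ← pow_add]
  have steps : ∀ k m, a + 1 ≤ m → x ^ (m + k * (d + 1)) = x ^ m := by
    intro k
    induction k with
    | zero => simp
    | succ k ih =>
      intro m hm
      rw [show m + (k + 1) * (d + 1) = m + k * (d + 1) + (d + 1) by ring, step _ (by omega),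
        ih m hm]
  refine ⟨(a + 1) * (d + 1), by positivity, ?_⟩
  rw [IsIdempotentElem, ← pow_add]
  exact steps (a + 1) _ (by nlinarith)

/-- A domain which is henselian at an ideal with finite quotient is a local ring. -/
theorem isLocalRing_of_henselianRing {R : Type*} [CommRing R] [IsDomain R] (I : Ideal R)
    [HenselianRing R I] [Finite (R ⧸ I)] : IsLocalRing R := by
  have hloc := isLocalHom_of_le_jacobson_bot I (HenselianRing.jac)
  refine IsLocalRing.of_isUnit_or_isUnit_one_sub_self fun b => ?_
  obtain ⟨n, hn, hid⟩ := exists_pow_isIdempotentElem (Ideal.Quotient.mk I b)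
  -- The idempotent `b ^ n` of the quotient lifts to a root of `X ^ 2 - X`, which in a domain is `0`
  -- or `1`; accordingly `1 - b` or `b` is a unit.
  obtain ⟨c, hc, hcb⟩ := HenselianRing.is_henselian (I := I) (Polynomial.X ^ 2 - Polynomial.X)
    (by monicity!) (b ^ n) (by
      rw [← Ideal.Quotient.eq_zero_iff_mem]
      simp only [Polynomial.eval_sub, Polynomial.eval_pow, Polynomial.eval_X, map_sub, map_pow]
      rw [sq, hid.eq, sub_self]) (by
      -- For an idempotent `ε` one has `(2ε - 1)² = 1`, so the derivative is its own inverse.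
      refine IsUnit.of_mul_eq_one (2 * (Ideal.Quotient.mk I b) ^ n - 1) ?_
      have h2 : (Ideal.Quotient.mk I b ^ n) ^ 2 = Ideal.Quotient.mk I b ^ n := by
        rw [sq, hid.eq]
      simp only [Polynomial.derivative_sub, Polynomial.derivative_X_pow, Polynomial.derivative_X]
      simp only [Nat.cast_ofNat, Nat.add_one_sub_one, pow_one, Polynomial.eval_sub,
        Polynomial.eval_mul, Polynomial.eval_X, Polynomial.eval_one, map_sub, map_mul, map_pow,
        map_one, Polynomial.eval_ofNat, map_ofNat]
      linear_combination 4 * h2)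
  have hcb' : Ideal.Quotient.mk I c = Ideal.Quotient.mk I b ^ n := by
    rw [← map_pow]; exact (Ideal.Quotient.eq).mpr hcb
  have : c * (c - 1) = 0 := by
    have : c ^ 2 - c = 0 := by simpa using hc
    linear_combination this
  rcases mul_eq_zero.mp this with h | h
  · right
    apply IsUnit.of_map (Ideal.Quotient.mk I)
    rw [h, map_zero] at hcb'
    rw [map_sub, map_one]
    exact IsNilpotent.isUnit_one_sub ⟨n, hcb'.symm⟩
  · left
    apply IsUnit.of_map (Ideal.Quotient.mk I)
    rw [sub_eq_zero.mp h, map_one] at hcb'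
    exact (isUnit_pow_iff hn).mp (hcb' ▸ isUnit_one)

end Completeness

/-! ### The ring of integers of the extension -/

section IntegralClosure

variable (A K L : Type*) [CommRing A] [IsDomain A] [IsDiscreteValuationRing A] [Field K]
  [Algebra A K] [IsFractionRing A K] [Field L] [Algebra K L] [Algebra A L] [IsScalarTower A K L]
  [FiniteDimensional K L] [Algebra.IsSeparable K L]

include K

theorem finite_integralClosure : Module.Finite A (integralClosure A L) :=
  IsIntegralClosure.finite A K L _

theorem free_integralClosure : Module.Free A (integralClosure A L) :=
  have : Module.IsTorsionFree A L := Module.IsTorsionFree.trans_faithfulSMul A K L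
  IsIntegralClosure.module_free A K L _

theorem isAdicComplete_integralClosure [IsAdicComplete (IsLocalRing.maximalIdeal A) A] :
    IsAdicComplete ((IsLocalRing.maximalIdeal A).map (algebraMap A (integralClosure A L)))
      (integralClosure A L) := by
  have := finite_integralClosure A K L
  have := free_integralClosure A K L
  rw [IsAdicComplete.map_algebraMap_iff]
  exact isAdicComplete_of_finite_free _ _

theorem isLocalRing_integralClosure [IsAdicComplete (IsLocalRing.maximalIdeal A) A]
    [Finite (IsLocalRing.ResidueField A)] : IsLocalRing (integralClosure A L) := by
  have := finite_integralClosure A K L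
  have := isAdicComplete_integralClosure A K L
  have : Finite (A ⧸ IsLocalRing.maximalIdeal A) := ‹Finite (IsLocalRing.ResidueField A)›
  have : Finite ((integralClosure A L) ⧸
    (IsLocalRing.maximalIdeal A).map (algebraMap A (integralClosure A L))) :=
    Module.finite_of_finite (A ⧸ IsLocalRing.maximalIdeal A)
  exact isLocalRing_of_henselianRing
    ((IsLocalRing.maximalIdeal A).map (algebraMap A (integralClosure A L)))

theorem isDiscreteValuationRing_integralClosure [IsLocalRing (integralClosure A L)] :
    IsDiscreteValuationRing (integralClosure A L) := by
  have := integralClosure.isDedekindDomain A K L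
  have : Module.IsTorsionFree A L := Module.IsTorsionFree.trans_faithfulSMul A K L
  have hf : ¬ IsField (integralClosure A L) := fun h =>
    IsDiscreteValuationRing.not_isField A (isField_of_isIntegral_of_isField
      (FaithfulSMul.algebraMap_injective A (integralClosure A L)) h)
  have h := (IsDiscreteValuationRing.TFAE (integralClosure A L) hf).out 0 2
  exact h.mpr inferInstance

theorem exists_map_maximalIdeal_eq_pow [IsDiscreteValuationRing (integralClosure A L)] :
    ∃ e, e ≠ 0 ∧ (IsLocalRing.maximalIdeal A).map (algebraMap A (integralClosure A L)) =
      IsLocalRing.maximalIdeal (integralClosure A L) ^ e ∧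
      (IsLocalRing.maximalIdeal (integralClosure A L)).ramificationIdx A = e := by
  have : Module.IsTorsionFree A L := Module.IsTorsionFree.trans_faithfulSMul A K L
  set P := IsLocalRing.maximalIdeal (integralClosure A L)
  set I := (IsLocalRing.maximalIdeal A).map (algebraMap A (integralClosure A L)) with hI
  have hI0 : I ≠ ⊥ := Ideal.map_ne_bot_of_ne_bot (IsDiscreteValuationRing.not_a_field A)
  have h := (IsDiscreteValuationRing.TFAE (integralClosure A L)
    (IsDiscreteValuationRing.not_isField _)).out 0 6
  obtain ⟨e, he⟩ := h.mp inferInstance I hI0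
  have hlies : P.LiesOver (IsLocalRing.maximalIdeal A) := inferInstance
  have hP0 : P ≠ ⊥ := IsDiscreteValuationRing.not_a_field _
  refine ⟨e, ?_, he, ?_⟩
  · rintro rfl
    rw [pow_zero, Ideal.one_eq_top] at he
    have h1 : I ≤ P := Ideal.map_le_iff_le_comap.mpr (hlies.over).le
    exact Ideal.IsPrime.ne_top' (top_le_iff.mp (he ▸ h1))
  · rw [Ideal.IsDedekindDomain.ramificationIdx_eq_normalizedFactors_count
      (IsLocalRing.maximalIdeal A) P hI0]
    have hirr : Irreducible P := (Ideal.prime_of_isPrime hP0 inferInstance).irreducible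
    rw [← hI, he, UniqueFactorizationMonoid.normalizedFactors_pow,
      UniqueFactorizationMonoid.normalizedFactors_irreducible hirr]
    simp

/-- The ideal extended from `A` is the `e`-th power of the maximal ideal, so completeness for the
former passes to the latter. -/
theorem henselianLocalRing_integralClosure [IsAdicComplete (IsLocalRing.maximalIdeal A) A]
    [IsDiscreteValuationRing (integralClosure A L)] : HenselianLocalRing (integralClosure A L) := by
  obtain ⟨e, he, h, -⟩ := exists_map_maximalIdeal_eq_pow A K L
  have := isAdicComplete_integralClosure A K L
  rw [h] at this
  have := IsAdicComplete.of_pow (IsLocalRing.maximalIdeal (integralClosure A L)) he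
  refine { is_henselian := fun f hf a h1 h2 => ?_ }
  exact HenselianRing.is_henselian f hf a h1 (h2.map _)

end IntegralClosure

open IsLocalRing

/-! ### Teichmüller lifts -/

section Teichmuller

open Polynomial

variable {B : Type*} [CommRing B] [HenselianLocalRing B]

omit [HenselianLocalRing B] in
theorem eq_of_pow_eq_of_residue_eq [IsLocalRing B] {n : ℕ} {a b : B}
    (hn : IsUnit (n : B)) (hab : a ^ n = b ^ n) (ha : IsUnit a)
    (h : residue B a = residue B b) : a = b := by
  refine eq_of_eval_eq_zero_of_not_isUnit_sub (f := X ^ n - C (b ^ n)) (by simp [hab]) (by simp)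
    (fun hu => ?_) ?_
  · rw [← residue_ne_zero_iff_isUnit, map_sub, h, sub_self] at hu
    exact hu rfl
  · rw [derivative_sub, derivative_C, sub_zero, derivative_X_pow]
    simpa using hn.mul (ha.pow (n - 1))

variable (B) in
/-- The Teichmüller section of a henselian local ring of characteristic `p` with finite residue
field. -/
theorem exists_teichmuller (p : ℕ) [Fact p.Prime] [CharP B p] [Finite (ResidueField B)] :
    ∃ θ : ResidueField B →+* B, (∀ a, residue B (θ a) = a) ∧
      ∀ b, b ^ Nat.card (ResidueField B) = b → θ (residue B b) = b := by
  have := Fintype.ofFinite (ResidueField B)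
  have hchar : CharP (ResidueField B) p := by
    have h' : (p : ResidueField B) = 0 := by
      rw [← map_natCast (residue B), CharP.cast_eq_zero, map_zero]
    exact ringChar.of_eq (CharP.ringChar_of_prime_eq_zero Fact.out h')
  obtain ⟨n, -, hn⟩ := FiniteField.card (ResidueField B) p
  have hq : Nat.card (ResidueField B) = p ^ (n : ℕ) := by rw [Nat.card_eq_fintype_card, hn]
  have hq0 : ((p ^ (n : ℕ) : ℕ) : B) = 0 := by
    rw [Nat.cast_pow, CharP.cast_eq_zero, zero_pow n.pos.ne']
  -- The fixed points of the `q`-power Frobenius form a subring in characteristic `p`. Reduction is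
  -- bijective on them because `X ^ q - X` has derivative `-1`: roots are separated by their
  -- residues and lift by Hensel.
  let T : Subring B := RingHom.eqLocus (iterateFrobenius B p n) (RingHom.id B)
  have hT : ∀ b, b ∈ T ↔ b ^ p ^ (n : ℕ) = b := fun b => by
    simp [T, RingHom.mem_eqLocus, iterateFrobenius_def]
  have hinj : Function.Injective ((residue B).comp T.subtype) := by
    rintro ⟨a, ha⟩ ⟨b, hb⟩ hab
    rw [hT] at ha hb
    refine Subtype.ext (eq_of_eval_eq_zero_of_not_isUnit_sub (f := X ^ p ^ (n : ℕ) - X)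
      (by simp [ha]) (by simp [hb]) (fun hu => ?_) ?_)
    · rw [← residue_ne_zero_iff_isUnit, map_sub] at hu
      exact hu (sub_eq_zero.mpr hab)
    · simp only [derivative_sub, derivative_X_pow, derivative_X, hq0, map_zero, zero_mul]
      simp
  have hsurj : Function.Surjective ((residue B).comp T.subtype) := by
    intro a
    obtain ⟨b, rfl⟩ := residue_surjective a
    obtain ⟨c, hc, hcb⟩ := HenselianLocalRing.is_henselian (X ^ p ^ (n : ℕ) - X : B[X])
      (monic_X_pow_sub (by
        rw [degree_X]
        exact_mod_cast (Nat.one_lt_pow n.pos.ne' (Fact.out : p.Prime).one_lt))) b (by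
        rw [← residue_eq_zero_iff]
        simp only [eval_sub, eval_pow, eval_X, map_sub, map_pow]
        rw [← hn, FiniteField.pow_card, sub_self]) (by
        simp only [derivative_sub, derivative_X_pow, derivative_X, hq0, map_zero, zero_mul]
        simp)
    refine ⟨⟨c, (hT c).mpr ?_⟩, ?_⟩
    · simpa [sub_eq_zero] using hc
    · rwa [← residue_eq_zero_iff, map_sub, sub_eq_zero] at hcb
  let E := RingEquiv.ofBijective _ ⟨hinj, hsurj⟩
  refine ⟨T.subtype.comp E.symm.toRingHom, fun a => E.apply_symm_apply a, fun b hb => ?_⟩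
  have : E.symm (residue B b) = ⟨b, (hT b).mpr (hq ▸ hb)⟩ := E.injective (by
    rw [E.apply_symm_apply]; rfl)
  exact congrArg Subtype.val this

theorem teichmuller_smul {G : Type*} [Group G] [MulSemiringAction G B]
    [Finite (ResidueField B)] {θ : ResidueField B →+* B} (hθ : ∀ a, residue B (θ a) = a)
    (hθ' : ∀ b, b ^ Nat.card (ResidueField B) = b → θ (residue B b) = b) (g : G)
    (a : ResidueField B) : g • θ a = θ (g • a) := by
  have := Fintype.ofFinite (ResidueField B)
  have h := hθ' (g • θ a) (by
    rw [← smul_pow', ← map_pow, Nat.card_eq_fintype_card, FiniteField.pow_card])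
  rw [← h, ResidueField.residue_smul, hθ]

end Teichmuller

/-! ### The action on the residue field -/

section Residue

variable {A B : Type*} [CommRing A] [IsLocalRing A] [CommRing B] [IsLocalRing B]
  [Algebra A B] [IsLocalHom (algebraMap A B)]
  {G : Type*} [Group G] [MulSemiringAction G B]

open scoped Pointwise in
theorem exists_smul_eq_algEquiv [Finite G] [IsGaloisGroup G A B]
    (σ : Gal(ResidueField B/ResidueField A)) :
    ∃ g : G, ∀ a, g • a = σ a := by
  obtain ⟨g, hg⟩ := Ideal.Quotient.stabilizerHom_surjective G (maximalIdeal A) (maximalIdeal B) σ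
  refine ⟨g, fun a => ?_⟩
  rw [← hg]
  obtain ⟨b, rfl⟩ := residue_surjective a
  rfl

instance [SMulCommClass G A B] : SMulCommClass G (ResidueField A) (ResidueField B) where
  smul_comm g a b := by
    obtain ⟨b, rfl⟩ := residue_surjective b
    obtain ⟨a, rfl⟩ := residue_surjective a
    rw [Algebra.smul_def, Algebra.smul_def, ResidueField.algebraMap_residue, smul_mul',
      ← ResidueField.residue_smul, smul_algebraMap]

theorem mem_inertia_iff_smul_residue (g : G) :
    g ∈ (maximalIdeal B).inertia G ↔ ∀ a : ResidueField B, g • a = a := by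
  refine ⟨fun h a => ?_, fun h b => ?_⟩
  · obtain ⟨b, rfl⟩ := residue_surjective a
    rw [← ResidueField.residue_smul, ← sub_eq_zero, ← map_sub, residue_eq_zero_iff]
    exact h b
  · change g • b - b ∈ maximalIdeal B
    rw [← residue_eq_zero_iff, map_sub, ResidueField.residue_smul, h, sub_self]

variable {H : Subgroup G}

theorem smul_residue_injective (hH : Disjoint ((maximalIdeal B).inertia G) H) {h h' : H}
    (hh : ∀ a : ResidueField B, (h : G) • a = (h' : G) • a) : h = h' := by
  have h1 : (h'⁻¹ * h : H) = 1 := by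
    have := Subgroup.disjoint_def.mp hH (x := ((h'⁻¹ * h : H) : G))
      ((mem_inertia_iff_smul_residue _).mpr fun a => by
        rw [Subgroup.coe_mul, mul_smul, hh, ← mul_smul]; simp) (h'⁻¹ * h : H).2
    exact Subtype.ext this
  rwa [inv_mul_eq_one, eq_comm] at h1

variable (A) in
/-- A complement of the inertia subgroup is the Galois group of the residue extension. -/
theorem exists_equiv_residue_aut [Finite G] [IsGaloisGroup G A B]
    (hH : ((maximalIdeal B).inertia G).IsComplement' H) :
    ∃ E : H ≃ Gal(ResidueField B/ResidueField A), ∀ h a, E h a = (h : G) • a := by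
  have hex : ∀ σ : Gal(ResidueField B/ResidueField A), ∃ h : H, ∀ a, (h : G) • a = σ a := by
    intro σ
    obtain ⟨g, hg⟩ := exists_smul_eq_algEquiv (G := G) σ
    obtain ⟨⟨t, h⟩, rfl⟩ := hH.2 g
    refine ⟨h, fun a => ?_⟩
    rw [← hg]
    simp only [mul_smul]
    exact ((mem_inertia_iff_smul_residue _).mp t.2 _).symm
  choose F hF using hex
  refine ⟨(Equiv.ofBijective F ⟨fun σ τ h => ?_, fun h => ?_⟩).symm, fun h a => ?_⟩
  · ext a
    rw [← hF, ← hF, h]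
  · refine ⟨AlgEquiv.ofRingEquiv (f := MulSemiringAction.toRingEquiv G _ (h : G)) fun a => ?_, ?_⟩
    · exact smul_algebraMap (h : G) a
    · exact smul_residue_injective hH.disjoint fun a => by rw [hF]; rfl
  · rw [← hF]
    congr 2
    exact (Equiv.ofBijective F _).apply_symm_apply h

end Residue

/-! ### An equivariant uniformizer -/

section Uniformizer

open Polynomial

variable {A B : Type*} [CommRing A] [IsDomain A] [IsDiscreteValuationRing A]
  [CommRing B] [IsDomain B] [IsDiscreteValuationRing B] [Algebra A B]
  [IsLocalHom (algebraMap A B)] [Finite (ResidueField B)]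
  {G : Type*} [Group G] [Finite G] [MulSemiringAction G B]
  {H : Subgroup G}

omit [Finite (ResidueField B)] [Finite G] in
theorem exists_smul_irreducible {π : B} (hπ : Irreducible π) (g : G) :
    ∃ u : Bˣ, g • π = u * π := by
  have : Irreducible (g • π) :=
    (MulEquiv.irreducible_iff (MulSemiringAction.toRingEquiv G B g)).mpr hπ
  obtain ⟨u, hu⟩ := IsDiscreteValuationRing.associated_of_irreducible B hπ this
  exact ⟨u, by rw [← hu, mul_comm]⟩

omit [Finite (ResidueField B)] in
/-- A subgroup that meets inertia trivially fixes a uniformizer. -/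
theorem exists_irreducible_fixed (hH : Disjoint ((maximalIdeal B).inertia G) H) :
    ∃ π : B, Irreducible π ∧ ∀ h ∈ H, h • π = π := by
  classical
  have := Fintype.ofFinite H
  obtain ⟨π, hπ⟩ := IsDiscreteValuationRing.exists_irreducible B
  choose u hu using exists_smul_irreducible (G := G) hπ
  let f : H → (ResidueField B →* ResidueField B) := fun h =>
    (MulSemiringAction.toRingHom G (ResidueField B) (h : G) : ResidueField B →* ResidueField B)
  have hf : Function.Injective f := fun h h' e =>
    smul_residue_injective hH fun a => DFunLike.congr_fun e a
  have hlin := (linearIndependent_monoidHom (ResidueField B) (ResidueField B)).comp f hf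
  -- Dedekind independence of the distinct automorphisms induced by `H`: the `H`-trace of a suitable
  -- `c * π` is still a uniformizer.
  have hc : ∃ c, ∑ h : H, residue B (u h) * (h : G) • c ≠ 0 := by
    by_contra! hc
    have := Fintype.linearIndependent_iff.mp hlin (fun h => residue B (u h)) (by
      ext c
      simpa [f] using hc c) 1
    exact (residue_ne_zero_iff_isUnit _).mpr (u (1 : H)).isUnit this
  obtain ⟨c, hc⟩ := hc
  obtain ⟨c, rfl⟩ := residue_surjective c
  have hsum : ∑ h : H, (h : G) • (c * π) = (∑ h : H, (u h : B) * (h : G) • c) * π := by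
    rw [Finset.sum_mul]
    refine Finset.sum_congr rfl fun h _ => ?_
    rw [smul_mul', hu]
    ring
  have hunit : IsUnit (∑ h : H, (u h : B) * (h : G) • c) := by
    rw [← residue_ne_zero_iff_isUnit]
    simpa [ResidueField.residue_smul] using hc
  refine ⟨∑ h : H, (h : G) • (c * π), ?_, fun h hh => ?_⟩
  · rw [hsum]
    exact (irreducible_isUnit_mul hunit).mpr hπ
  · rw [Finset.smul_sum]
    refine Fintype.sum_equiv (Equiv.mulLeft (⟨h, hh⟩ : H)) _ _ fun x => ?_
    rw [← mul_smul]
    rfl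

/-- In the split case there is a uniformizer with a power in the base ring, fixed modulo
principal units by the complement of inertia. -/
theorem exists_irreducible_pow_mem [HenselianLocalRing B] [IsGaloisGroup G A B]
    (hH : ((maximalIdeal B).inertia G).IsComplement' H)
    {e : ℕ} (he : (maximalIdeal A).map (algebraMap A B) = maximalIdeal B ^ e)
    (he' : (e : ResidueField B) ≠ 0) :
    ∃ (ϖ π w : B) (a : A), Irreducible ϖ ∧ ϖ ^ e = algebraMap A B a ∧ ϖ = w * π ∧
      residue B w = 1 ∧ ∀ h ∈ H, h • π = π := by
  obtain ⟨π, hπ, hπH⟩ := exists_irreducible_fixed hH.disjoint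
  obtain ⟨t, ht⟩ := IsDiscreteValuationRing.exists_irreducible A
  have hassoc : Associated (π ^ e) (algebraMap A B t) := by
    rw [ht.maximalIdeal_eq, hπ.maximalIdeal_eq, Ideal.map_span, Set.image_singleton,
      Ideal.span_singleton_pow, Ideal.span_singleton_eq_span_singleton] at he
    exact he.symm
  obtain ⟨u, hu⟩ := hassoc
  have hπ0 : π ^ e ≠ 0 := pow_ne_zero _ hπ.ne_zero
  have huH : ∀ h ∈ H, h • (u : B) = u := by
    intro h hh
    have : h • (π ^ e * (u : B)) = π ^ e * u := by rw [hu, smul_algebraMap]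
    rw [smul_mul', smul_pow', hπH h hh] at this
    exact mul_left_cancel₀ hπ0 this
  obtain ⟨E, hE⟩ := exists_equiv_residue_aut A hH
  -- `H` induces the whole Galois group of the residue extension, so the `H`-fixed unit `u` has its
  -- residue in the residue field of `A`.
  obtain ⟨r, hr⟩ : residue B u ∈ (⊥ : IntermediateField (ResidueField A) (ResidueField B)) := by
    rw [IsGalois.mem_bot_iff_fixed]
    intro σ
    rw [← E.apply_symm_apply σ, hE, ← ResidueField.residue_smul, huH _ (E.symm σ).2]
  have hr' : algebraMap (ResidueField A) (ResidueField B) r = residue B u := hr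
  obtain ⟨a, ha⟩ := residue_surjective r⁻¹
  have hua : residue B (u * algebraMap A B a) = 1 := by
    rw [map_mul, ← ResidueField.algebraMap_residue, ha, ← hr', ← map_mul, mul_inv_cancel₀, map_one]
    rintro rfl
    rw [map_zero] at hr'
    exact (residue_ne_zero_iff_isUnit _).mpr u.isUnit hr'.symm
  have he0 : e ≠ 0 := by rintro rfl; simp at he'
  -- By tameness `e` is invertible, so `u * a ≡ 1` has an `e`-th root `w ≡ 1`; then `(w * π) ^ e = t
  -- * a` comes from `A`.
  obtain ⟨w, hw, hw1⟩ := HenselianLocalRing.is_henselian (X ^ e - C (u * algebraMap A B a))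
    (monic_X_pow_sub_C _ he0) 1 (by
      rw [← residue_eq_zero_iff]
      simp only [eval_sub, eval_pow, eval_X, eval_C, map_sub, map_one, one_pow, hua,
        sub_self]) (by
      rw [derivative_sub, derivative_C, sub_zero, derivative_X_pow]
      simpa [← residue_ne_zero_iff_isUnit] using he')
  have hw' : w ^ e = u * algebraMap A B a := by
    rw [IsRoot, eval_sub, eval_pow, eval_X, eval_C, sub_eq_zero] at hw
    exact hw
  have hw1' : residue B w = 1 := by
    rwa [← residue_eq_zero_iff, map_sub, map_one, sub_eq_zero] at hw1
  refine ⟨w * π, π, w, t * a, ?_, ?_, rfl, hw1', hπH⟩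
  · refine (irreducible_isUnit_mul ?_).mpr hπ
    rw [← residue_ne_zero_iff_isUnit, hw1']
    exact one_ne_zero
  · rw [mul_pow, hw', map_mul, ← hu]
    ring

/-- In the split tame case there are a Teichmüller section `θ` and a uniformizer `ϖ` on which the
Galois group acts through roots of unity. -/
theorem exists_equivariant_uniformizer [HenselianLocalRing B] [IsGaloisGroup G A B]
    (p : ℕ) [Fact p.Prime] [CharP B p]
    (hH : ((maximalIdeal B).inertia G).IsComplement' H)
    {e : ℕ} (he : (maximalIdeal A).map (algebraMap A B) = maximalIdeal B ^ e)
    (he' : (e : ResidueField B) ≠ 0) :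
    ∃ (θ : ResidueField B →+* B) (ϖ : B) (χ : G → ResidueField B), Irreducible ϖ ∧
      (∀ a, residue B (θ a) = a) ∧ (∀ (g : G) a, g • θ a = θ (g • a)) ∧
      (∀ g : G, g • ϖ = θ (χ g) * ϖ) ∧ (∀ g, χ g ^ e = 1) ∧ (∀ h ∈ H, χ h = 1) ∧
      ∀ t ∈ (maximalIdeal B).inertia G, χ t = 1 → t = 1 := by
  obtain ⟨θ, hθ, hθ'⟩ := exists_teichmuller B p
  obtain ⟨ϖ, π, w, a, hϖ, hϖa, hw, hw1, hπ⟩ := exists_irreducible_pow_mem hH he he'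
  have hθg := fun (g : G) => teichmuller_smul hθ hθ' g
  choose ζ hζ using exists_smul_irreducible (G := G) hϖ
  have heu : IsUnit (e : B) := by
    rw [← residue_ne_zero_iff_isUnit, map_natCast]; exact he'
  have hζe : ∀ g, (ζ g : B) ^ e = 1 := by
    intro g
    have h1 : g • ϖ ^ e = ϖ ^ e := by rw [hϖa, smul_algebraMap]
    rw [smul_pow', hζ, mul_pow] at h1
    exact mul_right_cancel₀ (pow_ne_zero _ hϖ.ne_zero) (h1.trans (one_mul _).symm)
  have hχe : ∀ g, residue B (ζ g) ^ e = 1 := fun g => by rw [← map_pow, hζe, map_one]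
  -- Both sides are `e`-th roots of unity with the same residue, and `e` is a unit.
  have hθζ : ∀ g, θ (residue B (ζ g)) = ζ g := fun g =>
    (eq_of_pow_eq_of_residue_eq heu (by rw [hζe, ← map_pow, hχe, map_one]) (ζ g).isUnit
      (hθ _).symm).symm
  have hζϖ : ∀ g : G, g • ϖ = θ (residue B (ζ g)) * ϖ := fun g => by rw [hθζ, hζ]
  refine ⟨θ, ϖ, fun g => residue B (ζ g), hϖ, hθ, hθg, hζϖ, hχe, fun h hh => ?_, fun t ht h1 => ?_⟩
  · have h1 := hζ h
    have hπ0 : π ≠ 0 := by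
      rintro rfl
      exact hϖ.ne_zero (by rw [hw, mul_zero])
    rw [hw, smul_mul', hπ h hh, ← mul_assoc] at h1
    have h2 := congrArg (residue B) (mul_right_cancel₀ hπ0 h1)
    rw [ResidueField.residue_smul, map_mul, hw1, smul_one, mul_one] at h2
    exact h2.symm
  · have hϖt : t • ϖ = ϖ := by
      have := hζϖ t
      rwa [show residue B (ζ t) = 1 from h1, map_one, one_mul] at this
    have hθt : ∀ a, t • θ a = θ a := fun a => by
      rw [hθg, (mem_inertia_iff_smul_residue t).mp ht]
    -- Subtracting the leading Teichmüller digit and dividing by `ϖ`, both compatible with `t`,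
    -- gains one power of the maximal ideal.
    have key : ∀ n, ∀ b : B, t • b - b ∈ maximalIdeal B ^ n := by
      intro n
      induction n with
      | zero => simp
      | succ n ih =>
        intro b
        have hb : b - θ (residue B b) ∈ maximalIdeal B := by
          rw [← residue_eq_zero_iff, map_sub, hθ, sub_self]
        rw [hϖ.maximalIdeal_eq, Ideal.mem_span_singleton'] at hb
        obtain ⟨c, hc⟩ := hb
        have : t • b - b = (t • c - c) * ϖ := by
          rw [← sub_add_cancel b (θ (residue B b)), ← hc, smul_add, smul_mul', hϖt, hθt]
          ring
        rw [this, pow_succ]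
        refine Ideal.mul_mem_mul (ih c) ?_
        rw [hϖ.maximalIdeal_eq]
        exact Ideal.mem_span_singleton_self ϖ
    have hfaith : FaithfulSMul G B := IsGaloisGroup.faithful A
    refine hfaith.eq_of_smul_eq_smul fun b => ?_
    rw [one_smul, ← sub_eq_zero, ← Ideal.mem_bot,
      ← Ideal.iInf_pow_eq_bot_of_isLocalRing (maximalIdeal B) Ideal.IsPrime.ne_top',
      Submodule.mem_iInf]
    exact fun n => key n b

end Uniformizer

/-! ### Artin–Schreier theory of the residue field -/

section FiniteField

variable (κ : Type*) [Field κ] [Finite κ] (p : ℕ) [Fact p.Prime] [Algebra (ZMod p) κ]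

/-- Artin–Schreier theory of a finite field: an element of absolute trace `1` spans a complement
of the image of `x ↦ x ^ p - x`. -/
theorem exists_artinSchreier_generator :
    ∃ δ : κ, (∀ a, ∃ (c : ZMod p) (b : κ), a = c • δ + (b ^ p - b)) ∧
      (∀ (c : ZMod p) (b : κ), c • δ = b ^ p - b → c = 0) ∧
      ∀ σ : κ ≃+* κ, ∃ b, σ δ - δ = b ^ p - b := by
  let F : κ →ₗ[ZMod p] κ := (FiniteField.frobeniusAlgHom (ZMod p) κ).toLinearMap - LinearMap.id
  have hF : ∀ b, F b = b ^ p - b := fun b => by simp [F, ZMod.card]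
  have htrF : ∀ b, Algebra.trace (ZMod p) κ (F b) = 0 := by
    intro b
    have := Algebra.trace_eq_of_algEquiv
      (FiniteField.frobeniusAlgEquivOfAlgebraic (ZMod p) κ) b
    rw [hF, map_sub, sub_eq_zero, ← this]
    simp [ZMod.card]
  -- The kernel consists of elements fixed by Frobenius, which generates the Galois group, hence
  -- lies in `𝔽_p`.
  have hker : Module.finrank (ZMod p) (LinearMap.ker F) ≤ 1 := by
    have : LinearMap.ker F ≤ Submodule.span (ZMod p) {1} := by
      intro x hx
      rw [LinearMap.mem_ker, hF, sub_eq_zero] at hx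
      have hmem : x ∈ (⊥ : IntermediateField (ZMod p) κ) := by
        rw [IsGalois.mem_bot_iff_fixed]
        intro σ
        obtain ⟨n, rfl⟩ := (FiniteField.bijective_frobeniusAlgEquivOfAlgebraic_pow (ZMod p) κ).2 σ
        have : ∀ m : ℕ, (FiniteField.frobeniusAlgEquivOfAlgebraic (ZMod p) κ ^ m) x = x := by
          intro m
          induction m with
          | zero => rfl
          | succ m ih =>
            rw [pow_succ, AlgEquiv.mul_apply]
            simpa [ZMod.card, hx] using ih
        exact this n
      obtain ⟨c, rfl⟩ := hmem
      exact Submodule.mem_span_singleton.mpr ⟨c, by rw [Algebra.smul_def, mul_one]; rfl⟩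
    refine (Submodule.finrank_mono this).trans ?_
    rw [finrank_span_singleton one_ne_zero]
  -- The image lies in the kernel of the trace, and rank-nullity for both maps forces equality.
  have heq : LinearMap.range F = LinearMap.ker (Algebra.trace (ZMod p) κ) := by
    refine Submodule.eq_of_le_of_finrank_le ?_ ?_
    · rintro _ ⟨b, rfl⟩
      exact htrF b
    · have h1 := LinearMap.finrank_range_add_finrank_ker F
      have h2 := LinearMap.finrank_range_add_finrank_ker (Algebra.trace (ZMod p) κ)
      rw [LinearMap.range_eq_top.mpr (Algebra.trace_surjective (ZMod p) κ), finrank_top,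
        Module.finrank_self] at h2
      omega
  have hmem : ∀ a, Algebra.trace (ZMod p) κ a = 0 → ∃ b, a = b ^ p - b := by
    intro a ha
    obtain ⟨b, hb⟩ : a ∈ LinearMap.range F := heq ▸ ha
    exact ⟨b, by rw [← hb, hF]⟩
  obtain ⟨δ, hδ⟩ := Algebra.trace_surjective (ZMod p) κ 1
  refine ⟨δ, fun a => ?_, fun c b hcb => ?_, fun σ => ?_⟩
  · obtain ⟨b, hb⟩ := hmem (a - Algebra.trace (ZMod p) κ a • δ) (by simp [hδ])
    exact ⟨_, b, by rw [← hb]; ring⟩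
  · have := htrF b
    rw [hF, ← hcb, map_smul, hδ] at this
    simpa using this
  · refine hmem _ ?_
    have := Algebra.trace_eq_of_algEquiv (AlgEquiv.ofRingEquiv (f := σ) (fun c => by
      rw [← ZMod.natCast_zmod_val c, map_natCast, map_natCast]) : κ ≃ₐ[ZMod p] κ) δ
    rw [map_sub, sub_eq_zero]
    exact this

end FiniteField

/-! ### Normal forms modulo `℘(L)` -/

section Polar

variable {L : Type*} [Field L] {κ : Type*} [Field κ] (θ : κ →+* L) (x : L) (p : ℕ)

/-- The additive map `f ↦ ∑ θ (f n) x ^ n` on polynomials supported in degrees prime to `p`. -/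
noncomputable def polarMap : ({n : ℕ // ¬ p ∣ n} →₀ κ) →+ L :=
  Finsupp.liftAddHom fun n => (AddMonoidHom.mulRight (x ^ (n : ℕ))).comp θ.toAddMonoidHom

@[simp]
theorem polarMap_single (n : {n : ℕ // ¬ p ∣ n}) (a : κ) :
    polarMap θ x p (Finsupp.single n a) = θ a * x ^ (n : ℕ) := by
  simp [polarMap]

theorem polarMap_apply (f : {n : ℕ // ¬ p ∣ n} →₀ κ) :
    polarMap θ x p f = ∑ n ∈ f.support, θ (f n) * x ^ (n : ℕ) := by
  simp [polarMap, Finsupp.sum]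

variable {θ x p} {Γ : Type*} [LinearOrderedCommGroupWithZero Γ] {v : Valuation L Γ}

theorem val_le_one (hθ : ∀ a, a ≠ 0 → v (θ a) = 1) (b : κ) : v (θ b) ≤ 1 := by
  by_cases hb : b = 0
  · simp [hb]
  · exact (hθ b hb).le

/-- The term of largest exponent dominates. What matters later is that this exponent is prime to
`p`. -/
theorem exists_val_polarMap (hx : 1 < v x) (hθ : ∀ a, a ≠ 0 → v (θ a) = 1)
    {f : {n : ℕ // ¬ p ∣ n} →₀ κ} (hf : f ≠ 0) (a : κ) :
    ∃ n : {n : ℕ // ¬ p ∣ n}, v (θ a + polarMap θ x p f) = v x ^ (n : ℕ) := by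
  classical
  have hx0 : v x ≠ 0 := (zero_lt_one.trans hx).ne'
  obtain ⟨m, hm, hmax⟩ := f.support.exists_max_image (fun n => (n : ℕ))
    (Finsupp.support_nonempty_iff.mpr hf)
  refine ⟨m, ?_⟩
  have hm0 : (m : ℕ) ≠ 0 := fun h => m.2 (h ▸ dvd_zero p)
  have hvm : v (θ (f m) * x ^ (m : ℕ)) = v x ^ (m : ℕ) := by
    rw [map_mul, hθ _ (Finsupp.mem_support_iff.mp hm), one_mul, map_pow]
  have hsum : v (polarMap θ x p f) = v x ^ (m : ℕ) := by
    rw [polarMap_apply, ← hvm]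
    refine Valuation.map_sum_eq_of_lt v hm (fun n hn => ?_)
    · rw [hvm, map_mul, map_pow]
      simp only [Finset.mem_sdiff, Finset.mem_singleton] at hn
      have hlt : (n : ℕ) < m := lt_of_le_of_ne (hmax n hn.1) (fun h => hn.2 (Subtype.ext h))
      calc v (θ (f n)) * v x ^ (n : ℕ) ≤ 1 * v x ^ (n : ℕ) := by gcongr; exact val_le_one hθ _
        _ = v x ^ (n : ℕ) := one_mul _
        _ < v x ^ (m : ℕ) := pow_lt_pow_right₀ hx hlt
  rw [Valuation.map_add_eq_of_lt_right, hsum]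
  rw [hsum]
  exact (val_le_one hθ a).trans_lt (one_lt_pow₀ hx hm0)

variable (hx : 1 < v x) (hval : ∀ y, y ≠ 0 → ∃ n : ℤ, v y = v x ^ n)
  (hθ : ∀ a, a ≠ 0 → v (θ a) = 1)
  (hres : ∀ y, v y ≤ 1 → ∃ a, v (y - θ a) < 1)

-- If `z` has a pole, then `z ^ p - z` has valuation `v z ^ p`, a pole of order divisible by `p`;
-- otherwise it has no pole. Neither fits a nonzero polar part. Once `f = 0`, the element `z` is
-- integral, and reducing it yields `b`.
include hx hval hθ hres in
theorem eq_zero_of_polarMap_eq [Fact p.Prime] [CharP L p] {f : {n : ℕ // ¬ p ∣ n} →₀ κ} {a : κ}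
    {z : L} (h : θ a + polarMap θ x p f = z ^ p - z) : f = 0 ∧ ∃ b, a = b ^ p - b := by
  have hp : p ≠ 0 := (Fact.out : p.Prime).ne_zero
  have hp1 : 1 < p := (Fact.out : p.Prime).one_lt
  have hf : f = 0 := by
    by_contra hf
    obtain ⟨n, hn⟩ := exists_val_polarMap hx hθ hf a
    have hn0 : (n : ℕ) ≠ 0 := fun h => n.2 (h ▸ dvd_zero p)
    rw [h] at hn
    rcases le_or_gt (v z) 1 with hz | hz
    · have h1 : v (z ^ p - z) ≤ 1 := by
        refine (v.map_sub _ _).trans (max_le ?_ hz)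
        rw [map_pow]
        exact pow_le_one₀ zero_le hz
      exact absurd (one_lt_pow₀ hx hn0) (not_lt.mpr (hn ▸ h1))
    · obtain ⟨m, hm⟩ := hval z (by rintro rfl; simp at hz)
      have h1 : v (z ^ p - z) = v z ^ p := by
        rw [Valuation.map_sub_eq_of_lt_left, map_pow]
        rw [map_pow]
        exact lt_self_pow₀ hz hp1
      rw [h1, hm, ← zpow_natCast, ← zpow_natCast, ← zpow_mul] at hn
      have := zpow_right_injective₀ (zero_lt_one.trans hx) hx.ne' hn
      exact n.2 (by exact_mod_cast (Dvd.intro_left m this))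
  refine ⟨hf, ?_⟩
  rw [hf, map_zero, add_zero] at h
  have hz : v z ≤ 1 := by
    by_contra! hz
    have h1 : v (z ^ p - z) = v z ^ p := by
      rw [Valuation.map_sub_eq_of_lt_left, map_pow]
      rw [map_pow]
      exact lt_self_pow₀ hz hp1
    have h2 : 1 < v (θ a) := by
      rw [h, h1]
      exact one_lt_pow₀ hz hp
    by_cases ha : a = 0
    · simp [ha] at h2
    · exact h2.ne' (hθ a ha)
  obtain ⟨b, hb⟩ := hres z hz
  refine ⟨b, ?_⟩
  by_contra hne
  have h1 := hθ _ (sub_ne_zero.mpr hne)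
  -- If `a - (b ^ p - b)` were nonzero, its lift would be a unit, yet it equals the image under `℘`
  -- of an element of the maximal ideal.
  have h2 : θ (a - (b ^ p - b)) = (z - θ b) ^ p - (z - θ b) := by
    rw [sub_pow_char, map_sub, h]
    simp only [map_sub, map_pow]
    ring
  have h3 : v ((z - θ b) ^ p - (z - θ b)) < 1 := by
    refine (v.map_sub _ _).trans_lt (max_lt ?_ hb)
    rw [map_pow]
    exact pow_lt_one₀ zero_le hb hp
  rw [← h2, h1] at h3
  exact lt_irrefl _ h3

-- Induction on a bound for the pole order: the leading term is either recorded in `f` or, if its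
-- order is divisible by `p`, traded for one of lower order.
include hx hval hθ hres in
theorem exists_eq_polarMap_add [Fact p.Prime] [CharP L p]
    (hperf : ∀ a : κ, ∃ b, b ^ p = a) (has : ∀ y, v y < 1 → ∃ z, y = z ^ p - z) (y : L) :
    ∃ (a : κ) (f : {n : ℕ // ¬ p ∣ n} →₀ κ) (z : L),
      y = θ a + polarMap θ x p f + (z ^ p - z) := by
  have hx0 : v x ≠ 0 := (zero_lt_one.trans hx).ne'
  have hxL : x ≠ 0 := by rintro rfl; simp at hx0
  have hp1 : 1 < p := (Fact.out : p.Prime).one_lt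
  have key : ∀ d : ℕ, ∀ y, v y ≤ v x ^ d → ∃ (a : κ) (f : {n : ℕ // ¬ p ∣ n} →₀ κ) (z : L),
      y = θ a + polarMap θ x p f + (z ^ p - z) := by
    intro d
    induction d with
    | zero =>
      intro y hy
      obtain ⟨a, ha⟩ := hres y (by simpa using hy)
      obtain ⟨z, hz⟩ := has _ ha
      exact ⟨a, 0, z, by rw [← hz, map_zero]; ring⟩
    | succ d ih =>
      intro y hy
      obtain ⟨a, ha⟩ := hres (y / x ^ (d + 1)) (by
        rw [map_div₀, map_pow]
        exact div_le_one_of_le₀ hy zero_le)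
      -- Removing the leading term makes the valuation strictly smaller; as the values are powers of
      -- `v x`, the pole order drops by at least one.
      have hy' : v (y - θ a * x ^ (d + 1)) ≤ v x ^ d := by
        have h1 : v (y - θ a * x ^ (d + 1)) < v x ^ (d + 1) := by
          have : y - θ a * x ^ (d + 1) = (y / x ^ (d + 1) - θ a) * x ^ (d + 1) := by
            field_simp
          rw [this, map_mul, map_pow]
          exact mul_lt_of_lt_one_left (pow_pos (zero_lt_one.trans hx) _) ha
        by_cases h0 : y - θ a * x ^ (d + 1) = 0
        · rw [h0, map_zero]; exact zero_le
        obtain ⟨m, hm⟩ := hval _ h0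
        rw [hm, ← zpow_natCast] at h1 ⊢
        have := (zpow_lt_zpow_iff_right₀ hx).mp h1
        exact (zpow_le_zpow_iff_right₀ hx).mpr (by push_cast at this; omega)
      by_cases hd : p ∣ d + 1
      · obtain ⟨m, hm⟩ := hd
        obtain ⟨b, rfl⟩ := hperf a
        have hmd : m ≤ d := by
          have : m ≠ 0 := by rintro rfl; simp at hm
          nlinarith [Nat.pos_of_ne_zero this]
        have hle : v (θ b * x ^ m) ≤ v x ^ d := by
          rw [map_mul, map_pow]
          exact (mul_le_of_le_one_left zero_le (val_le_one hθ b)).trans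
            (pow_le_pow_right₀ hx.le hmd)
        -- With `d + 1 = p * m`, the leading term `θ (b ^ p) * x ^ (p * m)` is congruent to `θ b * x
        -- ^ m` modulo `℘(L)`, and `m ≤ d`.
        obtain ⟨a', f, z, h⟩ := ih (y - θ (b ^ p) * x ^ (d + 1) + θ b * x ^ m)
          ((v.map_add _ _).trans (max_le hy' hle))
        refine ⟨a', f, z + θ b * x ^ m, ?_⟩
        rw [add_pow_char, mul_pow, ← pow_mul, mul_comm m p, ← hm, ← map_pow]
        linear_combination h
      · obtain ⟨a', f, z, h⟩ := ih _ hy'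
        refine ⟨a', f + Finsupp.single ⟨d + 1, hd⟩ a, z, ?_⟩
        rw [map_add, polarMap_single]
        linear_combination h
  by_cases hy : y = 0
  · exact ⟨0, 0, 0, by simp [hy, (Fact.out : p.Prime).ne_zero]⟩
  obtain ⟨n, hn⟩ := hval y hy
  refine key n.toNat y ?_
  rw [hn, ← zpow_natCast]
  exact (zpow_le_zpow_iff_right₀ hx).mpr (Int.self_le_toNat n)

end Polar

/-! ### Exponents prime to `p`, sorted modulo `e` -/

section ResidueClasses

/-- By the Chinese remainder theorem each class modulo `e` contains infinitely many integers
congruent to `1` modulo `p`. Enumerating every class cuts the exponents into blocks with one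
representative per class. -/
theorem exists_equiv_residue_classes {p e : ℕ} (hp : 1 < p) (he : e ≠ 0) (hpe : p.Coprime e) :
    ∃ E : ℕ × Fin e ≃ {n : ℕ // ¬ p ∣ n}, ∀ j r, (E (j, r) : ℕ) % e = r := by
  have : NeZero e := ⟨he⟩
  let f : {n : ℕ // ¬ p ∣ n} → Fin e := fun n => Fin.ofNat e n
  have hinf : ∀ r, Infinite {n // f n = r} := by
    intro r
    obtain ⟨n, hn1, hn2⟩ := Nat.chineseRemainder hpe 1 r
    have hmod : ∀ m, n + p * e * m ≡ 1 [MOD p] := fun m => by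
      simpa [Nat.ModEq, mul_assoc] using hn1
    refine Infinite.of_injective (fun m : ℕ => (⟨⟨n + p * e * m, fun h => ?_⟩, ?_⟩ :
      {n // f n = r})) fun a b hab => ?_
    · have := (hmod m).symm.trans (Nat.modEq_zero_iff_dvd.mpr h)
      rw [Nat.ModEq, Nat.mod_eq_of_lt hp] at this
      simp at this
    · refine Fin.ext ?_
      have h1 : n + p * e * m ≡ r [MOD e] := by
        rw [mul_right_comm]
        simpa [Nat.ModEq] using hn2
      rw [Nat.ModEq, Nat.mod_eq_of_lt r.2] at h1
      simpa [f, Fin.ofNat] using h1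
    · simpa [he, (zero_lt_one.trans hp).ne'] using hab
  have hE : ∀ r, Nonempty (ℕ ≃ {n // f n = r}) := fun r =>
    have := hinf r
    (nonempty_denumerable {n // f n = r}).elim fun h => ⟨(@Denumerable.eqv _ h).symm⟩
  let E := fun r => (hE r).some
  refine ⟨(Equiv.prodComm _ _).trans ((Equiv.sigmaEquivProd _ _).symm.trans
    ((Equiv.sigmaCongrRight E).trans (Equiv.sigmaFiberEquiv f))), fun j r => ?_⟩
  exact congrArg Fin.val (E r j).2

end ResidueClasses

/-! ### One block is a free module of rank one -/

section Vandermonde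

variable {k κ G : Type*} [Field k] [Field κ] [Algebra k κ] [Group G] [Finite G]
  [MulSemiringAction G κ] {T H : Subgroup G} {e : ℕ} {ω : G → κ} {β : κ}

/-- Write `g = t * h`. In a relation, the coefficient of `ω t ^ r` is a combination of the
conjugates `h • β`. The `ω t` are distinct, so Vandermonde kills these combinations, and
independence of the conjugates kills the scalars. -/
theorem linearIndependent_smul_mul_pow (hTH : T.IsComplement' H) (he : Nat.card T = e)
    (hT : ∀ t ∈ T, ∀ a : κ, t • a = a) (hω : ∀ t ∈ T, ∀ h ∈ H, ω (t * h) = ω t)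
    (hinj : Set.InjOn ω T) (hβ : LinearIndependent k fun h : H => (h : G) • β) :
    LinearIndependent k fun (g : G) (r : Fin e) => (g • β) * ω g ^ (r : ℕ) := by
  classical
  have := Fintype.ofFinite G
  have := Fintype.ofFinite H
  let eT : Fin e ≃ T := (finCongr he.symm).trans (Finite.equivFin T).symm
  let E : T × H ≃ G := Equiv.ofBijective _ hTH
  have hE : ∀ t h, E (t, h) = t * h := fun _ _ => rfl
  rw [Fintype.linearIndependent_iff]
  intro c hc
  have hsum : ∀ r : Fin e, ∑ i : Fin e, (∑ h : H, c (E (eT i, h)) • (h : G) • β) *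
      ω (eT i) ^ (r : ℕ) = 0 := by
    intro r
    have := congrFun hc r
    rw [← E.sum_comp, Fintype.sum_prod_type, ← eT.sum_comp] at this
    simp only [Finset.sum_apply, Pi.smul_apply, Pi.zero_apply] at this
    rw [← this]
    refine Finset.sum_congr rfl fun i _ => ?_
    rw [Finset.sum_mul]
    refine Finset.sum_congr rfl fun h _ => ?_
    rw [hE, hω _ (eT i).2 _ h.2, mul_smul, hT _ (eT i).2, smul_mul_assoc]
  have hzero := Matrix.eq_zero_of_forall_pow_sum_mul_pow_eq_zero
    (f := fun i => ω (eT i)) (fun i j hij =>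
      eT.injective (Subtype.ext (hinj (eT i).2 (eT j).2 hij))) hsum
  intro g
  obtain ⟨⟨t, h⟩, rfl⟩ := E.surjective g
  have h1 := congrFun hzero (eT.symm t)
  simp only [Equiv.apply_symm_apply, Pi.zero_apply] at h1
  exact Fintype.linearIndependent_iff.mp hβ (fun h => c (E (t, h))) h1 h

/-- The orbit of `(β, …, β)` under a group acting through a normal basis and roots of unity. -/
theorem exists_addEquiv_pi (hTH : T.IsComplement' H) (he : Nat.card T = e)
    (hT : ∀ t ∈ T, ∀ a : κ, t • a = a) (hω : ∀ t ∈ T, ∀ h ∈ H, ω (t * h) = ω t)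
    (hinj : Set.InjOn ω T) (hβ : LinearIndependent k fun h : H => (h : G) • β)
    (hdim : Module.finrank k κ = Nat.card H) [FiniteDimensional k κ] :
    ∃ M : MonoidAlgebra k G ≃+ (Fin e → κ), ∀ g a r,
      M (MonoidAlgebra.single g a) r = a • ((g • β) * ω g ^ (r : ℕ)) := by
  have := Fintype.ofFinite G
  let b := basisOfLinearIndependentOfCardEqFinrank
    (linearIndependent_smul_mul_pow hTH he hT hω hinj hβ) (by
      rw [Module.finrank_pi_fintype, Finset.sum_const, Finset.card_univ, Fintype.card_fin, hdim,
        ← he, smul_eq_mul, hTH.card_mul_card, Nat.card_eq_fintype_card])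
  refine ⟨MonoidAlgebra.coeffAddEquiv.trans b.repr.symm.toAddEquiv, fun g a r => ?_⟩
  simp [b]

end Vandermonde

/-! ### Modules over the group algebra -/

section GroupAlgebra

variable {R G : Type*} [Group G] (p : ℕ) [Fact p.Prime]

/-- Additive equivariant maps between modules over `𝔽_p[G]` are linear. -/
theorem nonempty_linearEquiv {M N : Type*} [AddCommGroup M] [AddCommGroup N]
    [Module (MonoidAlgebra (ZMod p) G) M] [Module (MonoidAlgebra (ZMod p) G) N] (f : M ≃+ N)
    (hf : ∀ (g : G) x, f (MonoidAlgebra.single g (1 : ZMod p) • x) =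
      MonoidAlgebra.single g (1 : ZMod p) • f x) :
    Nonempty (M ≃ₗ[MonoidAlgebra (ZMod p) G] N) := by
  refine ⟨{ f with map_smul' := fun r x => ?_ }⟩
  change f (r • x) = r • f x
  induction r using MonoidAlgebra.induction_linear with
  | zero => simp
  | add r s hr hs => rw [add_smul, add_smul, map_add, hr, hs]
  | single g c =>
    have : MonoidAlgebra.single g c = c.val • MonoidAlgebra.single g (1 : ZMod p) := by
      rw [MonoidAlgebra.smul_single, nsmul_eq_mul, ZMod.natCast_zmod_val, mul_one]
    rw [this, smul_assoc, smul_assoc, map_nsmul, hf]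

variable {p} in
/-- Over a finite extension `k` of `𝔽_p`, the module `k[G]` is free of finite rank over `𝔽_p[G]`. -/
theorem exists_addEquiv_finsupp (k : Type*) [Field k] [Finite k] [Algebra (ZMod p) k] :
    ∃ (d : ℕ) (F : MonoidAlgebra k G ≃+ (Fin d →₀ MonoidAlgebra (ZMod p) G)), d ≠ 0 ∧
      ∀ g x, F (MonoidAlgebra.single g 1 * x) = MonoidAlgebra.single g (1 : ZMod p) • F x := by
  let b := Module.finBasis (ZMod p) k
  let F : MonoidAlgebra k G ≃+ (Fin (Module.finrank (ZMod p) k) →₀ MonoidAlgebra (ZMod p) G) :=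
    MonoidAlgebra.coeffAddEquiv.trans <|
      (Finsupp.mapRange.addEquiv b.repr.toAddEquiv).trans <|
      Finsupp.curryAddEquiv.symm.trans <|
      (Finsupp.domCongr (Equiv.prodComm _ _)).trans <|
      Finsupp.curryAddEquiv.trans <|
      Finsupp.mapRange.addEquiv MonoidAlgebra.coeffAddEquiv.symm
  have hF : ∀ h i (c : ZMod p), F (MonoidAlgebra.single h (c • b i)) =
      Finsupp.single i (MonoidAlgebra.single h c) := by
    intro h i c
    simp [F]
  refine ⟨_, F, Module.finrank_pos.ne', fun g x => ?_⟩
  induction x using MonoidAlgebra.induction_linear with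
  | zero => simp
  | add r s hr hs => rw [mul_add, map_add, map_add, hr, hs, smul_add]
  | single h a =>
    rw [MonoidAlgebra.single_mul_single, one_mul]
    have hsum : ∀ h, F (MonoidAlgebra.single h a) =
        ∑ i, Finsupp.single i (MonoidAlgebra.single h (b.repr a i)) := fun h => by
      rw [← b.sum_repr a, ← MonoidAlgebra.singleAddHom_apply, map_sum, map_sum]
      refine Finset.sum_congr rfl fun i _ => ?_
      rw [MonoidAlgebra.singleAddHom_apply, hF, b.sum_repr]
    rw [hsum, hsum, Finset.smul_sum]
    refine Finset.sum_congr rfl fun i _ => ?_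
    rw [Finsupp.smul_single, smul_eq_mul, MonoidAlgebra.single_mul_single, one_mul]

end GroupAlgebra

/-! ### Equivariant coordinates on the polar part -/

section Assembly

variable {k κ G : Type*} [Field k] [Field κ] [Algebra k κ] [Group G]
  [MulSemiringAction G κ] {e p : ℕ} {ω : G → κ} {β : κ}

/-- Coordinates on the polar part in which the group acts by left translation. -/
noncomputable def polarCoordinates (M : MonoidAlgebra k G ≃+ (Fin e → κ))
    (E : ℕ × Fin e ≃ {n : ℕ // ¬ p ∣ n}) :
    (ℕ →₀ MonoidAlgebra k G) ≃+ ({n : ℕ // ¬ p ∣ n} →₀ κ) :=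
  (Finsupp.mapRange.addEquiv
    (M.trans (Finsupp.linearEquivFunOnFinite κ κ (Fin e)).symm.toAddEquiv)).trans <|
    Finsupp.curryAddEquiv.symm.trans (Finsupp.domCongr E)

omit [Algebra k κ] [MulSemiringAction G κ] in
theorem polarMap_polarCoordinates_single {L : Type*} [Field L] (θ : κ →+* L) (x : L)
    (M : MonoidAlgebra k G ≃+ (Fin e → κ)) (E : ℕ × Fin e ≃ {n : ℕ // ¬ p ∣ n}) (j : ℕ)
    (y : MonoidAlgebra k G) :
    polarMap θ x p (polarCoordinates M E (Finsupp.single j y)) =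
      ∑ r, θ (M y r) * x ^ (E (j, r) : ℕ) := by
  have h : polarCoordinates M E (Finsupp.single j y) =
      ∑ r, Finsupp.single (E (j, r)) (M y r) := by
    have : (Finsupp.linearEquivFunOnFinite κ κ (Fin e)).symm (M y) =
        ∑ r, Finsupp.single r (M y r) :=
      (Finsupp.univ_sum_single _).symm
    simp [polarCoordinates, this, Finsupp.single_finsetSum]
  rw [h, map_sum]
  exact Finset.sum_congr rfl fun r _ => polarMap_single θ x p _ _

/-- Since `ω g ^ e = 1`, the factor by which `g` multiplies `x ^ n` depends only on `n` modulo `e`,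
and the exponents `E (j, r)` are congruent to `r`. The cocycle rule for `ω` then matches left
translation in `k[G]`. -/
theorem polarMap_polarCoordinates_smul {L : Type*} [Field L] [MulSemiringAction G L]
    [SMulCommClass G k κ] {θ : κ →+* L} {x : L}
    {M : MonoidAlgebra k G ≃+ (Fin e → κ)} {E : ℕ × Fin e ≃ {n : ℕ // ¬ p ∣ n}}
    (hE : ∀ j r, (E (j, r) : ℕ) % e = r)
    (hM : ∀ g a r, M (MonoidAlgebra.single g a) r = a • ((g • β) * ω g ^ (r : ℕ)))
    (hθ : ∀ (g : G) a, g • θ a = θ (g • a)) (hx0 : x ≠ 0)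
    (hx : ∀ g : G, g • x = θ (ω g) * x) (hω : ∀ g, ω g ^ e = 1) (g : G)
    (y : ℕ →₀ MonoidAlgebra k G) :
    polarMap θ x p (polarCoordinates M E (MonoidAlgebra.single g (1 : k) • y)) =
      g • polarMap θ x p (polarCoordinates M E y) := by
  have hcoc : ∀ h, ω (g * h) = (g • ω h) * ω g := by
    intro h
    apply θ.injective
    apply mul_right_cancel₀ hx0
    rw [← hx, mul_smul, hx, smul_mul', hθ, hx, map_mul, mul_assoc]
  induction y using Finsupp.induction_linear with
  | zero => simp
  | add y z hy hz => simp only [smul_add, map_add, hy, hz]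
  | single j y =>
    rw [Finsupp.smul_single, polarMap_polarCoordinates_single, polarMap_polarCoordinates_single]
    induction y using MonoidAlgebra.induction_linear with
    | zero => simp
    | add y z hy hz =>
      simp only [smul_add, map_add, Pi.add_apply, add_mul, Finset.sum_add_distrib, hy, hz]
    | single h a =>
      rw [smul_eq_mul, MonoidAlgebra.single_mul_single, one_mul, Finset.smul_sum]
      refine Finset.sum_congr rfl fun r _ => ?_
      rw [hM, hM, smul_mul', hθ, smul_pow', hx, mul_pow, ← mul_assoc, ← map_pow, ← map_mul,
        pow_eq_pow_mod _ (hω g), hE, smul_comm g a, smul_mul', smul_pow', hcoc, mul_pow, mul_smul,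
        Algebra.smul_def, Algebra.smul_def]
      congr 2
      ring

end Assembly

/-! ### The structure of `L⁺/℘(L⁺)` -/

section Main

variable {p : ℕ} [Fact p.Prime] {K L : Type*} [Field K] [Field L] [Algebra K L] [CharP K p]
  {k κ : Type*} [Field k] [Field κ] [Finite κ] [Algebra k κ] [MulSemiringAction Gal(L/K) κ]
  [SMulCommClass Gal(L/K) k κ] {Γ : Type*} [LinearOrderedCommGroupWithZero Γ]

omit [Algebra k κ] [SMulCommClass Gal(L/K) k κ] in
/-- The structure of `L⁺/℘(L⁺)` in terms of an equivariant coefficient field `θ`, the inverse `x`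
of an equivariant uniformizer, and coordinates for the polar part. -/
theorem exists_addEquiv_asQuotient {v : Valuation L Γ} {θ : κ →+* L} {x : L} (hx : 1 < v x)
    (hval : ∀ y, y ≠ 0 → ∃ n : ℤ, v y = v x ^ n) (hvθ : ∀ a, a ≠ 0 → v (θ a) = 1)
    (hres : ∀ y, v y ≤ 1 → ∃ a, v (y - θ a) < 1) (has : ∀ y, v y < 1 → ∃ z, y = z ^ p - z)
    (hθ : ∀ (g : Gal(L/K)) a, g • θ a = θ (g • a))
    (C : (ℕ →₀ MonoidAlgebra k Gal(L/K)) ≃+ ({n : ℕ // ¬ p ∣ n} →₀ κ))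
    (hC : ∀ (g : Gal(L/K)) y, polarMap θ x p (C (MonoidAlgebra.single g (1 : k) • y)) =
      g • polarMap θ x p (C y)) :
    ∃ Φ : (ZMod p × (ℕ →₀ MonoidAlgebra k Gal(L/K))) ≃+ ASQuotient K L p,
      ∀ g c y, Φ (c, MonoidAlgebra.single g (1 : k) • y) = asRep K L p g (Φ (c, y)) := by
  have hLp : CharP L p := charP_of_injective_algebraMap (algebraMap K L).injective p
  have hκp : CharP κ p := (RingHom.charP_iff θ θ.injective p).mpr hLp
  let _ : Algebra (ZMod p) κ := ZMod.algebra κ p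
  obtain ⟨δ, hδ1, hδ2, hδ3⟩ := exists_artinSchreier_generator κ p
  have hperf : ∀ a : κ, ∃ b, b ^ p = a := surjective_frobenius κ p
  let π : L →+ ASQuotient K L p := QuotientAddGroup.mk' _
  have hπ : ∀ y, π y = 0 ↔ ∃ z, y = z ^ p - z := fun y => by
    rw [← AddMonoidHom.mem_ker, QuotientAddGroup.ker_mk']
    exact ⟨fun ⟨z, hz⟩ => ⟨z, hz.symm⟩, fun ⟨z, hz⟩ => ⟨z, hz.symm⟩⟩
  have hπg : ∀ (g : Gal(L/K)) y, asRep K L p g (π y) = π (g • y) := fun g y => rfl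
  let ι : ZMod p →+ L := θ.toAddMonoidHom.comp
    (LinearMap.toSpanSingleton (ZMod p) κ δ).toAddMonoidHom
  let f : (ZMod p × (ℕ →₀ MonoidAlgebra k Gal(L/K))) →+ ASQuotient K L p :=
    π.comp (ι.coprod ((polarMap θ x p).comp C.toAddMonoidHom))
  have hf : ∀ c y, f (c, y) = π (θ (c • δ) + polarMap θ x p (C y)) := fun c y => rfl
  have hinj : Function.Injective f := by
    rw [injective_iff_map_eq_zero]
    rintro ⟨c, y⟩ h
    rw [hf, hπ] at h
    obtain ⟨z, hz⟩ := h
    obtain ⟨h1, b, hb⟩ := eq_zero_of_polarMap_eq hx hval hvθ hres hz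
    rw [hδ2 c b hb, C.map_eq_zero_iff.mp h1]
    rfl
  have hsurj : Function.Surjective f := by
    intro q
    obtain ⟨y, rfl⟩ := QuotientAddGroup.mk'_surjective _ q
    obtain ⟨a, w, z, hz⟩ := exists_eq_polarMap_add hx hval hvθ hres hperf has y
    obtain ⟨c, b, rfl⟩ := hδ1 a
    refine ⟨(c, C.symm w), ?_⟩
    rw [hf, eq_comm, ← sub_eq_zero]
    change π y - π _ = 0
    rw [← map_sub, hπ, C.apply_symm_apply, hz]
    refine ⟨θ b + z, ?_⟩
    rw [add_pow_char]
    simp only [map_add, map_sub, map_pow]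
    ring
  refine ⟨AddEquiv.ofBijective f ⟨hinj, hsurj⟩, fun g c y => ?_⟩
  change f _ = asRep K L p g (f _)
  rw [hf, hf, hπg, hC, eq_comm, ← sub_eq_zero, ← map_sub, smul_add, hθ, hπ]
  obtain ⟨b, hb⟩ := hδ3 (MulSemiringAction.toRingEquiv Gal(L/K) κ g)
  -- The line spanned by `δ` need not be stable in `κ`, but `g` moves it only within `℘(κ)`, so its
  -- image in the quotient is a trivial module.
  have hgδ : g • (c • δ) = c • δ + c • (b ^ p - b) := by
    rw [← hb, ← smul_add, add_sub_cancel, ← ZMod.natCast_zmod_val c, Nat.cast_smul_eq_nsmul,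
      Nat.cast_smul_eq_nsmul, smul_comm]
    rfl
  refine ⟨θ (c • b), ?_⟩
  have hcb : (c • b) ^ p = c • b ^ p := by
    rw [smul_pow, ZMod.pow_card]
  rw [hgδ, ← map_pow, hcb, smul_sub, map_add, map_sub]
  ring

end Main

/-! ### The valuation of a discrete valuation ring -/

section DiscreteValuation

variable {B L : Type*} [CommRing B] [IsDomain B] [IsDiscreteValuationRing B] [Field L]
  [Algebra B L] [IsFractionRing B L]

theorem valuation_algebraMap_eq_one_iff (b : B) :
    ValuationRing.valuation B L (algebraMap B L b) = 1 ↔ IsUnit b := by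
  constructor
  · intro h
    have hb : algebraMap B L b ≠ 0 := by
      rintro h0
      rw [h0, map_zero] at h
      exact zero_ne_one h
    have : ValuationRing.valuation B L (algebraMap B L b)⁻¹ ≤ 1 := by
      rw [map_inv₀, h, inv_one]
    obtain ⟨c, hc⟩ := (ValuationRing.mem_integer_iff B L _).mp this
    refine IsUnit.of_mul_eq_one c (IsFractionRing.injective B L ?_)
    rw [map_mul, hc, mul_inv_cancel₀ hb, map_one]
  · rintro ⟨u, rfl⟩
    refine le_antisymm ((ValuationRing.mem_integer_iff B L _).mpr ⟨_, rfl⟩) ?_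
    have h1 : ValuationRing.valuation B L (algebraMap B L (↑u⁻¹ : B)) ≤ 1 :=
      (ValuationRing.mem_integer_iff B L _).mpr ⟨_, rfl⟩
    have h2 : ValuationRing.valuation B L (algebraMap B L u) *
        ValuationRing.valuation B L (algebraMap B L (↑u⁻¹ : B)) = 1 := by
      rw [← map_mul, ← map_mul, Units.mul_inv, map_one, map_one]
    calc (1 : ValuationRing.ValueGroup B L) = _ := h2.symm
      _ ≤ _ := mul_le_of_le_one_right zero_le h1

theorem valuation_algebraMap_lt_one_iff (b : B) :
    ValuationRing.valuation B L (algebraMap B L b) < 1 ↔ b ∈ maximalIdeal B := by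
  rw [mem_maximalIdeal, mem_nonunits_iff, ← valuation_algebraMap_eq_one_iff (L := L),
    lt_iff_le_and_ne, and_iff_right]
  exact (ValuationRing.mem_integer_iff B L _).mpr ⟨_, rfl⟩

theorem exists_algebraMap_of_valuation_le_one {y : L} (hy : ValuationRing.valuation B L y ≤ 1) :
    ∃ b, algebraMap B L b = y :=
  (ValuationRing.mem_integer_iff B L _).mp hy

theorem exists_valuation_eq_zpow {ϖ : B} (hϖ : Irreducible ϖ) {y : L} (hy : y ≠ 0) :
    ∃ n : ℤ, ValuationRing.valuation B L y =
      ValuationRing.valuation B L (algebraMap B L ϖ)⁻¹ ^ n := by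
  have key : ∀ b : B, b ≠ 0 → ∃ n : ℕ, ValuationRing.valuation B L (algebraMap B L b) =
      ValuationRing.valuation B L (algebraMap B L ϖ) ^ n := by
    intro b hb
    obtain ⟨n, u, rfl⟩ := IsDiscreteValuationRing.eq_unit_mul_pow_irreducible hb hϖ
    exact ⟨n, by rw [map_mul, map_mul, (valuation_algebraMap_eq_one_iff _).mpr u.isUnit, one_mul,
      map_pow, map_pow]⟩
  obtain ⟨a, b, hb, rfl⟩ := IsFractionRing.div_surjective B y
  have ha : a ≠ 0 := by rintro rfl; simp at hy
  obtain ⟨m, hm⟩ := key a ha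
  obtain ⟨n, hn⟩ := key b (nonZeroDivisors.ne_zero hb)
  have h0 : ValuationRing.valuation B L (algebraMap B L ϖ) ≠ 0 := by
    rw [Valuation.ne_zero_iff]
    exact (map_ne_zero_iff _ (IsFractionRing.injective B L)).mpr hϖ.ne_zero
  refine ⟨n - m, ?_⟩
  rw [map_div₀, hm, hn, map_inv₀, inv_zpow, ← zpow_neg, neg_sub, zpow_sub₀ h0, zpow_natCast,
    zpow_natCast]

end DiscreteValuation

/-! ### The tame split case -/

section Tame

variable {p : ℕ} [Fact p.Prime] {A B K L : Type*} [Field K] [Field L] [Algebra K L] [CharP K p]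
  [CommRing A] [IsDomain A] [IsDiscreteValuationRing A]
  [CommRing B] [IsDomain B] [IsDiscreteValuationRing B] [HenselianLocalRing B]
  [Algebra A B] [IsLocalHom (algebraMap A B)] [Module.Finite A B] [Finite (ResidueField B)]
  [Algebra B L] [IsFractionRing B L] [FiniteDimensional K L]
  [MulSemiringAction Gal(L/K) B] [IsGaloisGroup Gal(L/K) A B]


theorem exists_addEquiv_of_tame
    (hBL : ∀ (g : Gal(L/K)) (b : B), algebraMap B L (g • b) = g • algebraMap B L b)
    {H : Subgroup Gal(L/K)} (hH : ((maximalIdeal B).inertia Gal(L/K)).IsComplement' H)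
    {e : ℕ} (he : (maximalIdeal A).map (algebraMap A B) = maximalIdeal B ^ e) (hpe : ¬ p ∣ e)
    (hcard : Nat.card ((maximalIdeal B).inertia Gal(L/K)) = e) :
    ∃ Φ : (ZMod p × (ℕ →₀ MonoidAlgebra (ResidueField A) Gal(L/K))) ≃+ ASQuotient K L p,
      ∀ g c y, Φ (c, MonoidAlgebra.single g (1 : ResidueField A) • y) =
        asRep K L p g (Φ (c, y)) := by
  have hp : p.Prime := Fact.out
  have he0 : e ≠ 0 := by rintro rfl; exact hpe (dvd_zero p)
  have hLp : CharP L p := charP_of_injective_algebraMap (algebraMap K L).injective p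
  have hBp : CharP B p := (RingHom.charP_iff _ (IsFractionRing.injective B L) p).mpr hLp
  have hp0 : (p : ResidueField B) = 0 := by
    rw [← map_natCast (residue B), CharP.cast_eq_zero, map_zero]
  have hκp : CharP (ResidueField B) p := ringChar.of_eq (CharP.ringChar_of_prime_eq_zero hp hp0)
  obtain ⟨θ, ϖ, χ, hϖ, hθ, hθg, hχ, hχe, hχH, hχT⟩ := exists_equivariant_uniformizer p hH he
    (by rwa [Ne, CharP.cast_eq_zero_iff _ p])
  obtain ⟨F, hF⟩ := exists_equiv_residue_aut A hH
  obtain ⟨β, hβ⟩ := exists_linearIndependent_algEquiv_apply (ResidueField A) (ResidueField B)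
  have hβ' : LinearIndependent (ResidueField A) fun h : H => (h : Gal(L/K)) • β := by
    simp_rw [← hF]
    exact hβ.comp F F.injective
  have hcoc : ∀ g h, χ (g * h) = (g • χ h) * χ g := by
    intro g h
    apply θ.injective
    apply mul_right_cancel₀ hϖ.ne_zero
    rw [← hχ, mul_smul, hχ, smul_mul', hθg, hχ, map_mul, mul_assoc]
  have hT := fun t => (mem_inertia_iff_smul_residue (B := B) (G := Gal(L/K)) t).mp
  have hχ0 : ∀ g, χ g ≠ 0 := fun g h => by
    have := hχe g
    rw [h, zero_pow he0] at this
    exact zero_ne_one this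
  -- The inverse appears because `G` acts on `x = ϖ⁻¹` through `(χ g)⁻¹`. On inertia, which fixes
  -- `κ`, the cocycle `χ` is a homomorphism, so its trivial kernel there makes it injective.
  obtain ⟨M, hM⟩ := exists_addEquiv_pi (ω := fun g => (χ g)⁻¹) hH hcard hT
    (fun t ht h hh => by rw [hcoc, hT t ht, hχH h hh, one_mul]) (fun t ht t' ht' htt' => by
      have h1 : χ t = χ t' := inv_injective htt'
      have h2 : χ (t'⁻¹ * t) = 1 := by
        have h3 := hcoc t' (t'⁻¹ * t)
        rw [mul_inv_cancel_left, hT t' ht', h1] at h3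
        exact (mul_eq_right₀ (hχ0 t')).mp h3.symm
      have h4 := hχT _ (mul_mem (inv_mem ht') ht) h2
      rwa [inv_mul_eq_one, eq_comm] at h4) hβ' (by
      rw [← IsGalois.card_aut_eq_finrank, Nat.card_congr F])
  obtain ⟨E, hE⟩ := exists_equiv_residue_classes hp.one_lt he0 ((hp.coprime_iff_not_dvd).mpr hpe)
  have hϖ0 : algebraMap B L ϖ ≠ 0 :=
    (map_ne_zero_iff _ (IsFractionRing.injective B L)).mpr hϖ.ne_zero
  have hx0 : (algebraMap B L ϖ)⁻¹ ≠ 0 := inv_ne_zero hϖ0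
  have hϖm : ϖ ∈ maximalIdeal B := by
    rw [hϖ.maximalIdeal_eq]; exact Ideal.mem_span_singleton_self ϖ
  have hθL : ∀ (g : Gal(L/K)) a, g • ((algebraMap B L).comp θ) a =
      ((algebraMap B L).comp θ) (g • a) := fun g a => by
    rw [RingHom.comp_apply, ← hBL, hθg]; rfl
  refine exists_addEquiv_asQuotient (v := ValuationRing.valuation B L)
    (θ := (algebraMap B L).comp θ) (x := (algebraMap B L ϖ)⁻¹) ?_
    (fun y hy => exists_valuation_eq_zpow hϖ hy) (fun a ha => ?_) (fun y hy => ?_) (fun y hy => ?_)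
    hθL (polarCoordinates M E) ?_
  · rw [map_inv₀]
    exact (one_lt_inv₀ (zero_lt_iff.mpr ((Valuation.ne_zero_iff _).mpr hϖ0))).mpr
      ((valuation_algebraMap_lt_one_iff ϖ).mpr hϖm)
  · rw [RingHom.comp_apply, valuation_algebraMap_eq_one_iff, ← residue_ne_zero_iff_isUnit, hθ]
    exact ha
  · obtain ⟨b, rfl⟩ := exists_algebraMap_of_valuation_le_one hy
    refine ⟨residue B b, ?_⟩
    rw [RingHom.comp_apply, ← map_sub, valuation_algebraMap_lt_one_iff, ← residue_eq_zero_iff,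
      map_sub, hθ, sub_self]
  · obtain ⟨b, rfl⟩ := exists_algebraMap_of_valuation_le_one hy.le
    rw [valuation_algebraMap_lt_one_iff] at hy
    -- For `b` in the maximal ideal, `0` is an approximate root of `X ^ p - X - b`, whose derivative
    -- is `-1`.
    obtain ⟨c, hc, -⟩ := HenselianLocalRing.is_henselian
      (Polynomial.X ^ p - Polynomial.X - Polynomial.C b)
      (by
        rw [sub_sub]
        refine Polynomial.monic_X_pow_sub ?_
        rw [Polynomial.degree_X_add_C]
        exact_mod_cast hp.one_lt) 0 (by
        simpa [hp.ne_zero] using hy) (by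
        simp [Polynomial.derivative_X_pow])
    refine ⟨algebraMap B L c, ?_⟩
    rw [← map_pow, ← map_sub]
    congr 1
    rw [Polynomial.IsRoot, Polynomial.eval_sub, sub_eq_zero] at hc
    simpa using hc.symm
  · refine polarMap_polarCoordinates_smul hE hM hθL hx0 (fun g => ?_) (fun g => ?_)
    · rw [smul_inv'', ← hBL, hχ, map_mul, mul_inv, map_inv₀]; rfl
    · rw [inv_pow, hχe, inv_one]

end Tame

theorem isLocalHom_algebraMap_integralClosure (A K L : Type*) [CommRing A] [IsDomain A] [Field K]
    [Algebra A K] [IsFractionRing A K] [Field L] [Algebra K L] [Algebra A L] [IsScalarTower A K L] :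
    IsLocalHom (algebraMap A (integralClosure A L)) := by
  have : Module.IsTorsionFree A L := Module.IsTorsionFree.trans_faithfulSMul A K L
  infer_instance

theorem flat_integralClosure (A K L : Type*) [CommRing A] [IsDomain A] [IsDiscreteValuationRing A]
    [Field K] [Algebra A K] [IsFractionRing A K] [Field L] [Algebra K L] [Algebra A L]
    [IsScalarTower A K L] [FiniteDimensional K L] [Algebra.IsSeparable K L] :
    Module.Flat A (integralClosure A L) :=
  have := free_integralClosure A K L
  Module.Flat.of_free

/-! ### Application to local fields -/

section LocalField

variable {p : ℕ} [Fact p.Prime]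
    {K : Type*} [Field K] [ValuativeRel K] [TopologicalSpace K] [IsNonarchimedeanLocalField K]
    [CharP K p]
    {L : Type*} [Field L] [Algebra K L] [FiniteDimensional K L] [IsGalois K L]

omit [TopologicalSpace K] [IsNonarchimedeanLocalField K] [FiniteDimensional K L] [IsGalois K L] in
theorem inertiaSubgroup_eq [IsLocalRing (IntegersIn K L)] :
    inertiaSubgroup K L = (maximalIdeal (IntegersIn K L)).inertia Gal(L/K) := by
  ext g
  change (∀ x : IntegersIn K L, g • x - x ∈ Ideal.jacobson ⊥) ↔
    ∀ x : IntegersIn K L, g • x - x ∈ maximalIdeal (IntegersIn K L)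
  rw [jacobson_eq_maximalIdeal _ bot_ne_top]

omit [TopologicalSpace K] [IsNonarchimedeanLocalField K] [FiniteDimensional K L] [IsGalois K L] in
theorem IsSplit.exists_isComplement' (h : IsSplit K L) :
    ∃ H, (inertiaSubgroup K L).IsComplement' H := by
  obtain ⟨s, hs⟩ := h
  refine ⟨s.range, Subgroup.isComplement'_of_disjoint_and_mul_eq_univ ?_ ?_⟩
  · rw [Subgroup.disjoint_def]
    rintro _ hx ⟨c, rfl⟩
    have := hs c
    rw [QuotientGroup.mk'_apply, (QuotientGroup.eq_one_iff _).mpr hx] at this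
    rw [← this, map_one]
  · rw [Set.eq_univ_iff_forall]
    intro g
    refine ⟨g * (s (QuotientGroup.mk' _ g))⁻¹, ?_, s (QuotientGroup.mk' _ g), ⟨_, rfl⟩,
      inv_mul_cancel_right _ _⟩
    rw [SetLike.mem_coe, ← QuotientGroup.eq_one_iff]
    change QuotientGroup.mk' (inertiaSubgroup K L) _ = 1
    rw [map_mul, map_inv, hs, mul_inv_cancel]

omit [FiniteDimensional K L] [IsGalois K L] in
theorem single_smul_residueGroupAlgebra (g : Gal(L/K)) (z : ResidueGroupAlgebra K L) :
    MonoidAlgebra.single g (1 : ZMod p) • z = MonoidAlgebra.single g (1 : 𝓀[K]) • z := by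
  change MonoidAlgebra.mapRingHom Gal(L/K) (ZMod.castHom (dvd_refl p) 𝓀[K]) _ • z = _
  rw [MonoidAlgebra.mapRingHom_single, map_one]

theorem exists_addEquiv_of_isTamelyRamified
    (htame : IsTamelyRamified K L) (hsplit : IsSplit K L) :
    ∃ Φ : (ZMod p × (ℕ →₀ MonoidAlgebra 𝓀[K] Gal(L/K))) ≃+ ASQuotient K L p,
      ∀ g c y, Φ (c, MonoidAlgebra.single g (1 : 𝓀[K]) • y) = asRep K L p g (Φ (c, y)) := by
  -- The uniform structure of the additive group gives access to completeness of `K`, hence to adic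
  -- completeness of `𝒪[K]`.
  let _ := IsTopologicalAddGroup.rightUniformSpace K
  have := isUniformAddGroup_of_addCommGroup (G := K)
  have : IsAdicComplete (maximalIdeal 𝒪[K]) 𝒪[K] := inferInstance
  have := finite_integralClosure 𝒪[K] K L
  have : Module.Flat 𝒪[K] (IntegersIn K L) := flat_integralClosure 𝒪[K] K L
  have := isLocalRing_integralClosure 𝒪[K] K L
  have := isDiscreteValuationRing_integralClosure 𝒪[K] K L
  have := henselianLocalRing_integralClosure 𝒪[K] K L
  have := isLocalHom_algebraMap_integralClosure 𝒪[K] K L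
  have : IsFractionRing (IntegersIn K L) L :=
    IsIntegralClosure.isFractionRing_of_finite_extension 𝒪[K] K L _
  have : IsGaloisGroup Gal(L/K) 𝒪[K] (IntegersIn K L) :=
    IsGaloisGroup.of_isFractionRing _ _ _ K L
  have : Finite (ResidueField (IntegersIn K L)) := ResidueField.finite_of_finite inferInstance
    (R := 𝒪[K])
  obtain ⟨e, -, he, hram⟩ := exists_map_maximalIdeal_eq_pow 𝒪[K] K L
  obtain ⟨H, hH⟩ := hsplit.exists_isComplement'
  rw [inertiaSubgroup_eq] at hH
  refine exists_addEquiv_of_tame (fun g b => rfl) hH he ?_ ?_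
  · have := htame (maximalIdeal (IntegersIn K L)) inferInstance
    rwa [hram, ringChar.eq_iff.mpr (residueField_charP K p)] at this
  -- With a perfect (here finite) residue field, the inertia group has order equal to the
  -- ramification index.
  · have : PerfectField (maximalIdeal 𝒪[K]).ResidueField := by
      have : Finite (𝒪[K] ⧸ maximalIdeal 𝒪[K]) := inferInstanceAs (Finite 𝓀[K])
      have : Finite (maximalIdeal 𝒪[K]).ResidueField := Finite.of_surjective _
        (Ideal.bijective_algebraMap_quotient_residueField (maximalIdeal 𝒪[K])).2
      infer_instance
    rw [← hram, Ideal.card_inertia_eq_ramificationIdxIn (maximalIdeal 𝒪[K]),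
      Ideal.ramificationIdxIn_eq_ramificationIdx (maximalIdeal 𝒪[K])
        (maximalIdeal (IntegersIn K L)) Gal(L/K)]

end LocalField

end LittleGalois

/-! ### The two module descriptions -/

theorem mainTheorem2 {p : ℕ} [Fact p.Prime]
    {K : Type*} [Field K] [ValuativeRel K] [TopologicalSpace K] [IsNonarchimedeanLocalField K]
    [CharP K p]
    {L : Type*} [Field L] [Algebra K L] [FiniteDimensional K L] [IsGalois K L]
    (htame : LittleGalois.IsTamelyRamified K L) (hsplit : LittleGalois.IsSplit K L) :
    Nonempty ((LittleGalois.asRep K L p).asModule ≃ₗ[MonoidAlgebra (ZMod p) Gal(L/K)]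
      (Representation.trivial (ZMod p) Gal(L/K) (ZMod p)).asModule ×
        (ℕ →₀ LittleGalois.ResidueGroupAlgebra K L)) ∧
    Nonempty ((LittleGalois.asRep K L p).asModule ≃ₗ[MonoidAlgebra (ZMod p) Gal(L/K)]
      (Representation.trivial (ZMod p) Gal(L/K) (ZMod p)).asModule ×
        (ℕ →₀ MonoidAlgebra (ZMod p) Gal(L/K))) := by
  obtain ⟨Φ, hΦ⟩ := LittleGalois.exists_addEquiv_of_isTamelyRamified (p := p) htame hsplit
  have hsmul : ∀ (g : Gal(L/K)) x, Φ (x.1, MonoidAlgebra.single g (1 : 𝓀[K]) • x.2) =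
      LittleGalois.asRep K L p g (Φ x) := fun g x => hΦ g x.1 x.2
  constructor
  · let f : (Representation.trivial (ZMod p) Gal(L/K) (ZMod p)).asModule ×
        (ℕ →₀ LittleGalois.ResidueGroupAlgebra K L) ≃+ (LittleGalois.asRep K L p).asModule := Φ
    refine (LittleGalois.nonempty_linearEquiv p f fun g x => ?_).map LinearEquiv.symm
    have h1 : MonoidAlgebra.single g (1 : ZMod p) • x.1 = x.1 := by
      rw [Representation.single_smul, one_smul]; rfl
    have h2 : MonoidAlgebra.single g (1 : ZMod p) • x.2 =
        (show ℕ →₀ MonoidAlgebra 𝓀[K] Gal(L/K) from MonoidAlgebra.single g (1 : 𝓀[K]) • x.2) := by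
      refine Finsupp.ext fun j => ?_
      exact LittleGalois.single_smul_residueGroupAlgebra g (x.2 j)
    rw [Representation.single_smul, one_smul]
    refine Eq.trans ?_ (hsmul g x)
    exact congrArg f (Prod.ext h1 h2)
  · let _ : Algebra (ZMod p) 𝓀[K] := ZMod.algebra _ p
    obtain ⟨d, F, hd, hF⟩ := LittleGalois.exists_addEquiv_finsupp (p := p) (G := Gal(L/K)) 𝓀[K]
    -- A nonzero rank makes `ℕ × Fin d` countably infinite, so the copies of `𝔽_p[G]` can be
    -- reindexed by `ℕ`.
    have : NeZero d := ⟨hd⟩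
    obtain ⟨i⟩ : Nonempty (ℕ × Fin d ≃ ℕ) :=
      (nonempty_denumerable (ℕ × Fin d)).elim fun h => ⟨@Denumerable.eqv _ h⟩
    let F' : (ℕ →₀ MonoidAlgebra 𝓀[K] Gal(L/K)) ≃+ (ℕ →₀ MonoidAlgebra (ZMod p) Gal(L/K)) :=
      (Finsupp.mapRange.addEquiv F).trans <| Finsupp.curryAddEquiv.symm.trans (Finsupp.domCongr i)
    have hF' : ∀ (g : Gal(L/K)) x, F' (MonoidAlgebra.single g (1 : 𝓀[K]) • x) =
        MonoidAlgebra.single g (1 : ZMod p) • F' x := by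
      intro g x
      refine Finsupp.ext fun n => ?_
      obtain ⟨⟨j, r⟩, rfl⟩ := i.surjective n
      have h : ∀ y m r, F' y (i (m, r)) = F (y m) r := fun y m r => by
        simp [F', Finsupp.domCongr]
      rw [h, Finsupp.smul_apply, Finsupp.smul_apply, smul_eq_mul, hF, h]
      rfl
    let f : (Representation.trivial (ZMod p) Gal(L/K) (ZMod p)).asModule ×
        (ℕ →₀ MonoidAlgebra (ZMod p) Gal(L/K)) ≃+ (LittleGalois.asRep K L p).asModule :=
      ((AddEquiv.refl (ZMod p)).prodCongr F').symm.trans Φ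
    refine (LittleGalois.nonempty_linearEquiv p f fun g x => ?_).map LinearEquiv.symm
    have h1 : MonoidAlgebra.single g (1 : ZMod p) • x.1 = x.1 := by
      rw [Representation.single_smul, one_smul]; rfl
    have h2 : F'.symm (MonoidAlgebra.single g (1 : ZMod p) • x.2) =
        MonoidAlgebra.single g (1 : 𝓀[K]) • F'.symm x.2 := by
      rw [AddEquiv.symm_apply_eq, hF', AddEquiv.apply_symm_apply]
    rw [Representation.single_smul, one_smul]
    refine Eq.trans ?_ (hsmul g (x.1, F'.symm x.2))
    exact congrArg Φ (Prod.ext h1 h2)
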